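/- **Theorem 1.5 (Variation of the velocity to dissipation energy/work).** Let $T\in(0,\infty]$ and let $\{\Gamma(t)\}_{0\le t<T}$ be an evolving $2$-dimensional surface in $\mathbb R^3$, i.e. each $\Gamma(t)$ is compact, $\Gamma(0)$ is, near each of its points, the zero set of a $C^2$ function with nowhere vanishing gradient, and, for $0<t_0<T$ and $x_0\in\Gamma(t_0)$, there are $r_1,r_2>0$ and $\psi(x,t)$ on $B_{r_1}(x_0)\times\{t>0:|t-t_0|<r_2\}$ such that $\psi$ and $\partial_t\psi$ together with their spatial derivatives of order at most $2$ exist and are continuous, $\nabla_x\psi\ne0$, and $\Gamma(t_0)\cap B_{r_1}(x_0)=\{x\in B_{r_1}(x_0):\psi(x,t_0)=0\}$. (Thus each $\Gamma(t)$ is a closed $C^2$-surface.) Let $n=n(x,t)$ be a unit normal vector of $\Gamma(t)$ at $x\in\Gamma(t)$ (the choice of sign is irrelevant), and put $$P_\Gamma=I-n\otimes n,\qquad \partial_i^\Gamma=\sum_{j=1}^3(\delta_{ij}-n_in_j)\partial_j,\qquad \operatorname{div}_\Gamma V=\sum_{j=1}^3\partial_j^\Gamma V_j,\qquad (\operatorname{div}_\Gamma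 M)_i=\sum_{j=1}^3\partial_j^\Gamma M_{ij},$$ $$D(V)=\tfrac12\{\nabla V+{}^t(\nabla V)\},\qquad D_\Gamma(V)=P_\Gamma D(V)P_\Gamma,\qquad |D_\Gamma(V)|^2=D_\Gamma(V):D_\Gamma(V),$$ for vector fields $V$ and $3\times 3$ matrix fields $M$. For a function defined on the surface only, $\partial_i^\Gamma$ is the derivative along the surface in the tangential direction $P_\Gamma e_i$. Let $v,F$ (vector-valued) and $\rho,\sigma,\mu,\lambda$ (real-valued) be smooth functions on $\mathbb R^3\times\mathbb R$; in particular $v$ may be the total velocity and $\rho$ the density of a fluid on $\Gamma(t)$. With $\mathcal H^2$ the $2$-dimensional Hausdorff measure (surface area), let $$E_D[V](t)=-\int_{\Gamma(t)}\tfrac12\left(2\mu|D_\Gamma(V)|^2+\lambda|\operatorname{div}_\Gamma V|^2\right)d\mathcal H^2_x,\quad E_{W_1}[V](t)=\int_{\Gamma(t)}(\operatorname{div}_\Gamma V)\,\sigma\,d\mathcal H^2_x,\quad E_{W_2}[V](t)=\int_{\Gamma(t)}\rho F\cdot V\,d\mathcal H^2_x,$$ $E_{D+W}=E_D+E_{W_1}+E_{W_2}$,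 and let $$S_\Gamma(v,\sigma,\mu,\lambda)=2\mu D_\Gamma(v)+\lambda P_\Gamma(\operatorname{div}_\Gamma v)-P_\Gamma\sigma$$ be the Boussinesq–Scriven surface stress tensor. Fix $t\in(0,T)$ and let $\varphi:\mathbb R^3\to\mathbb R^3$ be smooth (so $\varphi|_{\Gamma(t)}$ is an arbitrary element of $[C^\infty(\Gamma(t))]^3=[C_0^\infty(\Gamma(t))]^3$). Then $S_\Gamma(v,\sigma,\mu,\lambda)$ is differentiable along $\Gamma(t)$, all integrals occurring here converge absolutely, $\varepsilon\mapsto E_{D+W}[v+\varepsilon\varphi](t)$ is differentiable at $\varepsilon=0$, and $$\frac{d}{d\varepsilon}\bigg|_{\varepsilon=0}E_{D+W}[v+\varepsilon\varphi](t)=\int_{\Gamma(t)}\left\{\operatorname{div}_\Gamma S_\Gamma(v,\sigma,\mu,\lambda)+\rho F\right\}(x,t)\cdot\varphi(x)\,d\mathcal H^2_x.$$ Moreover, if $\varphi\cdot n=0$ on $\Gamma(t)$, then $$\frac{d}{d\varepsilon}\bigg|_{\varepsilon=0}E_{D+W}[v+\varepsilon\varphi](t)=\int_{\Gamma(t)}\left\{P_\Gamma\operatorname{div}_\Gamma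 S_\Gamma(v,\sigma,\mu,\lambda)+P_\Gamma\rho F\right\}(x,t)\cdot\varphi(x)\,d\mathcal H^2_x.$$ -/

import Mathlib

open scoped MeasureTheory ContDiff Matrix

/-- Three-dimensional Euclidean space. -/
abbrev E3 : Type := EuclideanSpace ℝ (Fin 3)

/-- A two-dimensional `C²`-surface in `ℝ³`: near each of its points it is the zero set of a
`C²` function with nowhere vanishing gradient. -/
def IsC2Surface (S : Set E3) : Prop :=
  ∀ x₀ ∈ S, ∃ r : ℝ, 0 < r ∧ ∃ f : E3 → ℝ,
    ContDiffOn ℝ 2 f (Metric.ball x₀ r) ∧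
    S ∩ Metric.ball x₀ r = {x | x ∈ Metric.ball x₀ r ∧ f x = 0} ∧
    ∀ x ∈ Metric.ball x₀ r, fderiv ℝ f x ≠ 0

/-- `ψ ∈ C^{2,1}(B × I)` for open `B ⊆ ℝ³`, `I ⊆ ℝ`: the function `ψ` and its time derivative
`∂ₜψ` exist, are twice differentiable in space, and all their spatial derivatives of order at most
two are jointly continuous on `B × I`. -/
def IsC21On (ψ : E3 → ℝ → ℝ) (B : Set E3) (I : Set ℝ) : Prop :=
  (∀ x ∈ B, DifferentiableOn ℝ (fun t => ψ x t) I) ∧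
  (∀ t ∈ I, ContDiffOn ℝ 2 (fun x => ψ x t) B) ∧
  (∀ t ∈ I, ContDiffOn ℝ 2 (fun x => deriv (fun s => ψ x s) t) B) ∧
  (∀ k : ℕ, k ≤ 2 →
    ContinuousOn (fun p : E3 × ℝ => iteratedFDeriv ℝ k (fun x => ψ x p.2) p.1) (B ×ˢ I)) ∧
  (∀ k : ℕ, k ≤ 2 →
    ContinuousOn
      (fun p : E3 × ℝ => iteratedFDeriv ℝ k (fun x => deriv (fun s => ψ x s) p.2) p.1) (B ×ˢ I))

/-- `{Γ(t)}_{0 ≤ t < T}` is an evolving two-dimensional surface in `ℝ³` on `[0,T)`: it is of class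
`C^{2,1}`, and each `Γ(t)` is a closed (i.e. compact, without boundary) surface. -/
structure IsEvolvingSurface (T : EReal) (Γ : ℝ → Set E3) : Prop where
  initial : IsC2Surface (Γ 0)
  regular : ∀ t₀ : ℝ, 0 < t₀ → (t₀ : EReal) < T → ∀ x₀ ∈ Γ t₀,
    ∃ r₁ r₂ : ℝ, 0 < r₁ ∧ 0 < r₂ ∧ ∃ ψ : E3 → ℝ → ℝ,
      IsC21On ψ (Metric.ball x₀ r₁) (Set.Ioi 0 ∩ Metric.ball t₀ r₂) ∧
      Γ t₀ ∩ Metric.ball x₀ r₁ = {x | x ∈ Metric.ball x₀ r₁ ∧ ψ x t₀ = 0} ∧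
      ∀ x ∈ Metric.ball x₀ r₁, ∀ t ∈ Set.Ioi 0 ∩ Metric.ball t₀ r₂,
        fderiv ℝ (fun y => ψ y t) x ≠ 0
  closed : ∀ t : ℝ, 0 ≤ t → (t : EReal) < T → IsCompact (Γ t)

/-- `n` is a unit normal vector field of `S`: at each point of `S` it is a unit vector orthogonal to
all tangent vectors of `S`. -/
def IsUnitNormalField (S : Set E3) (n : E3 → E3) : Prop :=
  ∀ x ∈ S, ‖n x‖ = 1 ∧ ∀ τ ∈ tangentConeAt ℝ S x, inner ℝ (n x) τ = 0

noncomputable section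

/-- The orthogonal projection `P_Γ = I - n ⊗ n` onto the tangent space. -/
def surfProj (n : E3 → E3) (x : E3) : Matrix (Fin 3) (Fin 3) ℝ :=
  Matrix.of fun i j => (if i = j then 1 else 0) - n x i * n x j

/-- A matrix acting on a vector of `ℝ³`. -/
def matVec (M : Matrix (Fin 3) (Fin 3) ℝ) (w : E3) : E3 :=
  WithLp.toLp 2 fun i => ∑ j, M i j * w j

/-- The tangential derivative `∂ᵢ^Γ f = ∑ⱼ (δᵢⱼ - nᵢ nⱼ) ∂ⱼ f` of a function on the surface `S`.
The derivative is taken within `S`, so that only the values of `f` on `S` matter: if `f` is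
the restriction of a function `g` differentiable at `x`, the derivative of `f` within `S` and that
of `g` agree on tangent vectors, and `∑ⱼ (δᵢⱼ - nᵢ nⱼ) eⱼ` is tangent. -/
def surfDeriv (S : Set E3) (n : E3 → E3) (i : Fin 3) (f : E3 → ℝ) (x : E3) : ℝ :=
  fderivWithin ℝ f S x (WithLp.toLp 2 fun j => surfProj n x i j)

/-- Surface divergence of a vector field. -/
def surfDiv (S : Set E3) (n : E3 → E3) (V : E3 → E3) (x : E3) : ℝ :=
  ∑ j, surfDeriv S n j (fun y => V y j) x

/-- Surface divergence of a matrix field: the vector with components `∑ⱼ ∂ⱼ^Γ Mᵢⱼ`. -/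
def surfDivMat (S : Set E3) (n : E3 → E3) (M : E3 → Matrix (Fin 3) (Fin 3) ℝ) (x : E3) : E3 :=
  WithLp.toLp 2 fun i => ∑ j, surfDeriv S n j (fun y => M y i j) x

/-- The strain rate tensor `D(V) = (∇V + ᵗ∇V)/2`. -/
def strainRate (V : E3 → E3) (x : E3) : Matrix (Fin 3) (Fin 3) ℝ :=
  Matrix.of fun i j =>
    (fderiv ℝ (fun y => V y j) x (EuclideanSpace.single i 1) +
      fderiv ℝ (fun y => V y i) x (EuclideanSpace.single j 1)) / 2

/-- The surface strain rate tensor `D_Γ(V) = P_Γ D(V) P_Γ`. -/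
def surfStrainRate (n : E3 → E3) (V : E3 → E3) (x : E3) : Matrix (Fin 3) (Fin 3) ℝ :=
  surfProj n x * strainRate V x * surfProj n x

/-- `|M|² = M : M`. -/
def frobSq (M : Matrix (Fin 3) (Fin 3) ℝ) : ℝ := ∑ i, ∑ j, M i j * M i j

/-- The surface stress tensor
`S_Γ(V, σ, μ, λ) = 2 μ D_Γ(V) + λ P_Γ (div_Γ V) - P_Γ σ` (Boussinesq–Scriven). -/
def surfStress (S : Set E3) (n : E3 → E3) (V : E3 → E3) (σ mu lam : E3 → ℝ) (x : E3) :
    Matrix (Fin 3) (Fin 3) ℝ :=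
  (2 * mu x) • surfStrainRate n V x + (lam x * surfDiv S n V x) • surfProj n x
    - σ x • surfProj n x

/-- The density `½ (2 μ |D_Γ(V)|² + λ |div_Γ V|²)` of the dissipation energy. -/
def dissipationDensity (S : Set E3) (n : E3 → E3) (mu lam : E3 → ℝ) (V : E3 → E3) (x : E3) : ℝ :=
  (1 / 2) * (2 * mu x * frobSq (surfStrainRate n V x) + lam x * |surfDiv S n V x| ^ 2)

/-- The power density `(div_Γ V) σ` of the pressure. -/
def pressureWorkDensity (S : Set E3) (n : E3 → E3) (σ : E3 → ℝ) (V : E3 → E3) (x : E3) : ℝ :=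
  surfDiv S n V x * σ x

/-- The power density `ρ F · V` of the exterior force. -/
def forceWorkDensity (ρ : E3 → ℝ) (F V : E3 → E3) (x : E3) : ℝ :=
  inner ℝ (ρ x • F x) (V x)

/-- `E_D[V] = -∫_Γ ½ (2 μ |D_Γ(V)|² + λ |div_Γ V|²) dℋ²`. The measure `μHE[2]` is the
two-dimensional Hausdorff measure with the normalization that gives surface area. -/
def dissipationEnergy (S : Set E3) (n : E3 → E3) (mu lam : E3 → ℝ) (V : E3 → E3) : ℝ :=
  -∫ x in S, dissipationDensity S n mu lam V x ∂μHE[2]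

/-- `E_{W₁}[V] = ∫_Γ (div_Γ V) σ dℋ²`. -/
def pressureWork (S : Set E3) (n : E3 → E3) (σ : E3 → ℝ) (V : E3 → E3) : ℝ :=
  ∫ x in S, pressureWorkDensity S n σ V x ∂μHE[2]

/-- `E_{W₂}[V] = ∫_Γ ρ F · V dℋ²`. -/
def forceWork (S : Set E3) (ρ : E3 → ℝ) (F V : E3 → E3) : ℝ :=
  ∫ x in S, forceWorkDensity ρ F V x ∂μHE[2]

/-- `E_{D+W}[V] = E_D[V] + E_{W₁}[V] + E_{W₂}[V]`. -/
def totalEnergy (S : Set E3) (n : E3 → E3) (mu lam σ ρ : E3 → ℝ) (F V : E3 → E3) : ℝ :=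
  dissipationEnergy S n mu lam V + pressureWork S n σ V + forceWork S ρ F V

/-- The field `div_Γ S_Γ(V, σ, μ, λ) + ρ F`. -/
def totalForce (S : Set E3) (n : E3 → E3) (mu lam σ ρ : E3 → ℝ) (F V : E3 → E3) (x : E3) : E3 :=
  surfDivMat S n (surfStress S n V σ mu lam) x + ρ x • F x

/-- The field `P_Γ div_Γ S_Γ(V, σ, μ, λ) + P_Γ ρ F`. -/
def tangentialForce (S : Set E3) (n : E3 → E3) (mu lam σ ρ : E3 → ℝ) (F V : E3 → E3) (x : E3) :
    E3 :=
  matVec (surfProj n x) (surfDivMat S n (surfStress S n V σ mu lam) x)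
    + matVec (surfProj n x) (ρ x • F x)

end

/-! Time is only a parameter: at a fixed `t` the set `S = Γ(t)` is a compact `C²`-surface. Both
`D_Γ` and `div_Γ` are linear in the velocity, so the energy along `v + ε φ` is a quadratic
polynomial in `ε`. Its derivative at `0` is the linear coefficient, and no differentiation under the
integral sign is needed.

The stress part of this coefficient is minus the integral of `S_Γ : (∇φ P_Γ)`, since `S_Γ` is built
from `P_Γ` and the symmetric `P_Γ D(v) P_Γ` and thus sees only `D_Γ(φ)` and `div_Γ φ`
(`IsC2Surface.frobInner_surfStress`). The product rule gives `div_Γ(ᵗS_Γ φ) = div_Γ S_Γ · φ + S_Γ :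
(∇φ P_Γ)`. As `S_Γ n = 0`, the field `ᵗS_Γ φ` is tangential, so its divergence integrates to zero
with no curvature term (`IsC2Surface.integral_surfDiv_eq_zero`). For tangential `φ` the projection
`P_Γ` can be inserted freely.

The analytic core is this divergence theorem. The implicit function theorem makes `S` locally a `C²`
graph. With area element `J = √(1 + |∇g|²)`, a tangential field with frame coordinates `y₀, y₁, y₂`
satisfies `J div_Γ Y = ∂₀(J y₀) + ∂₁(J y₁)`. The area formula turns `μHE[2]` into `J du`, the plane
integral of a compactly supported divergence vanishes, and a partition of unity globalizes.
Regularity just suffices: `P_Γ`, hence `S_Γ`, is `C¹` along `S`. -/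

/-! ### The area formula for injective immersions of the plane -/

/-- The Euclidean plane. -/
abbrev E2 : Type := EuclideanSpace ℝ (Fin 2)

section AreaFormula

open MeasureTheory Topology Filter
open scoped NNReal ENNReal

/-- The area factor `√(|L e₁|² |L e₂|² - ⟨L e₁, L e₂⟩²)` of a linear map on the plane. -/
noncomputable def areaFactor {F : Type*} [NormedAddCommGroup F] [InnerProductSpace ℝ F]
    (L : E2 →L[ℝ] F) : ℝ :=
  √(‖L (EuclideanSpace.single 0 1)‖ ^ 2 * ‖L (EuclideanSpace.single 1 1)‖ ^ 2
    - inner ℝ (L (EuclideanSpace.single 0 1)) (L (EuclideanSpace.single 1 1)) ^ 2)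

variable {F : Type*} [NormedAddCommGroup F] [InnerProductSpace ℝ F]

theorem continuous_areaFactor : Continuous (areaFactor : (E2 →L[ℝ] F) → ℝ) := by
  unfold areaFactor
  fun_prop

/-- The range of `L` is a Euclidean plane; identifying it isometrically with `E2` turns `L` into an
automorphism `A` whose determinant measures the area distortion. -/
theorem exists_continuousLinearEquiv_norm_eq (L : E2 →L[ℝ] F) (hL : Function.Injective L) :
    ∃ A : E2 ≃L[ℝ] E2, ∀ w, ‖A w‖ = ‖L w‖ := by
  have hfin : Module.finrank ℝ (LinearMap.range (L : E2 →ₗ[ℝ] F)) = 2 := by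
    rw [LinearMap.finrank_range_of_inj hL]; simp
  let ι := (stdOrthonormalBasis ℝ (LinearMap.range (L : E2 →ₗ[ℝ] F))).equiv
    (EuclideanSpace.basisFun (Fin 2) ℝ) (finCongr hfin)
  let e := LinearEquiv.ofInjective (L : E2 →ₗ[ℝ] F) hL
  refine ⟨(e.trans ι.toLinearEquiv).toContinuousLinearEquiv, fun w => ?_⟩
  change ‖ι (e w)‖ = ‖L w‖
  rw [ι.norm_map]
  rfl

/-- By polarization `A` and `L` have the same Gram matrix, and the Gram determinant of `A` is `(det
A)²`. -/
theorem abs_det_eq_areaFactor (A : E2 ≃L[ℝ] E2) (L : E2 →L[ℝ] F) (h : ∀ w, ‖A w‖ = ‖L w‖) :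
    |LinearMap.det (A : E2 →ₗ[ℝ] E2)| = areaFactor L := by
  have hin : ∀ w z, inner ℝ (A w) (A z) = inner ℝ (L w) (L z) := fun w z => by
    rw [real_inner_eq_norm_add_mul_self_sub_norm_mul_self_sub_norm_mul_self_div_two,
      real_inner_eq_norm_add_mul_self_sub_norm_mul_self_sub_norm_mul_self_div_two,
      ← map_add, ← map_add, h, h, h]
  rw [areaFactor, ← h, ← h, ← hin, ← Real.sqrt_sq_eq_abs]
  congr 1
  rw [← LinearMap.det_toMatrix (EuclideanSpace.basisFun (Fin 2) ℝ).toBasis, Matrix.det_fin_two]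
  simp only [LinearMap.toMatrix_apply, OrthonormalBasis.coe_toBasis,
    OrthonormalBasis.coe_toBasis_repr_apply, EuclideanSpace.basisFun_apply,
    EuclideanSpace.basisFun_repr, EuclideanSpace.norm_sq_eq, PiLp.inner_apply, Fin.sum_univ_two,
    Real.norm_eq_abs, sq_abs, RCLike.inner_apply, conj_trivial,
    LinearEquiv.coe_coe, ContinuousLinearEquiv.coe_toLinearEquiv]
  ring

theorem areaFactor_pos (L : E2 →L[ℝ] F) (hL : Function.Injective L) : 0 < areaFactor L := by
  obtain ⟨A, hA⟩ := exists_continuousLinearEquiv_norm_eq L hL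
  rw [← abs_det_eq_areaFactor A L hA, abs_pos]
  exact (LinearEquiv.isUnit_det' A.toLinearEquiv).ne_zero

/-- Near a point, an immersion of the plane is almost isometric up to a linear map. -/
theorem HasStrictFDerivAt.exists_nhds_norm_sub_le {Ψ : E2 → F} {L : E2 →L[ℝ] F} {x : E2}
    (hΨ : HasStrictFDerivAt Ψ L x) (A : E2 ≃L[ℝ] E2) (hA : ∀ w, ‖A w‖ = ‖L w‖)
    {k : ℝ} (hk : 1 < k) :
    ∃ s ∈ 𝓝 x, ∀ u ∈ s, ∀ v ∈ s,
      ‖Ψ u - Ψ v‖ ≤ k * ‖A (u - v)‖ ∧ ‖A (u - v)‖ ≤ k * ‖Ψ u - Ψ v‖ := by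
  set M : ℝ := ‖(A.symm : E2 →L[ℝ] E2)‖
  have hM : 0 ≤ M := norm_nonneg _
  have hk0 : 0 < k := by linarith
  have hd : 0 < 1 - k⁻¹ := sub_pos.2 (inv_lt_one_of_one_lt₀ hk)
  -- The linearization error `c ‖u - v‖` must stay below `(1 - k⁻¹) ‖A (u - v)‖`, and `‖u - v‖ ≤ M
  -- ‖A (u - v)‖`; the `+ 1` keeps the denominator positive.
  set c : ℝ := (1 - k⁻¹) / (M + 1)
  have hc : 0 < c := by positivity
  have hcM : c * M ≤ 1 - k⁻¹ := by
    rw [div_mul_eq_mul_div, div_le_iff₀ (by linarith)]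
    nlinarith
  obtain ⟨s, hs, happ⟩ := hΨ.approximates_deriv_on_nhds (c := ⟨c, hc.le⟩) (Or.inr hc)
  refine ⟨s, hs, fun u hu v hv => ?_⟩
  have h1 : ‖Ψ u - Ψ v - L (u - v)‖ ≤ c * ‖u - v‖ := happ u hu v hv
  have h2 : ‖u - v‖ ≤ M * ‖A (u - v)‖ := by
    simpa using (A.symm : E2 →L[ℝ] E2).le_opNorm (A (u - v))
  have h3 : ‖Ψ u - Ψ v - L (u - v)‖ ≤ (1 - k⁻¹) * ‖A (u - v)‖ := by
    calc _ ≤ c * (M * ‖A (u - v)‖) := h1.trans (by gcongr)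
      _ = (c * M) * ‖A (u - v)‖ := by ring
      _ ≤ _ := by gcongr
  have h4 : ‖Ψ u - Ψ v‖ ≤ ‖Ψ u - Ψ v - L (u - v)‖ + ‖L (u - v)‖ := norm_le_norm_sub_add _ _
  have h5 : ‖L (u - v)‖ ≤ ‖Ψ u - Ψ v - L (u - v)‖ + ‖Ψ u - Ψ v‖ := by
    rw [norm_sub_rev (Ψ u - Ψ v)]; exact norm_le_norm_sub_add _ _
  rw [← hA] at h4 h5
  -- With this, the single error bound `h3` yields both inequalities.
  have h6 : 1 - k⁻¹ ≤ k - 1 := by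
    rw [← sub_nonneg]
    have : k - 1 - (1 - k⁻¹) = (k - 1) ^ 2 / k := by field_simp
    rw [this]; positivity
  constructor
  · nlinarith [norm_nonneg (A (u - v))]
  · have : k⁻¹ * ‖A (u - v)‖ ≤ ‖Ψ u - Ψ v‖ := by linarith
    rwa [inv_mul_le_iff₀ hk0] at this

theorem LipschitzOnWith.euclideanHausdorffMeasure_image_le {X Y : Type*} [EMetricSpace X]
    [EMetricSpace Y] [MeasurableSpace X] [BorelSpace X] [MeasurableSpace Y] [BorelSpace Y]
    {K : ℝ≥0} {f : X → Y} {s : Set X} (h : LipschitzOnWith K f s) (d : ℕ) :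
    (μHE[d] : Measure Y) (f '' s) ≤ (K : ℝ≥0∞) ^ d * (μHE[d] : Measure X) s := by
  simp only [Measure.euclideanHausdorffMeasure_def, Measure.smul_apply]
  have := h.hausdorffMeasure_image_le (d := d) d.cast_nonneg
  rw [ENNReal.rpow_natCast] at this
  rw [ENNReal.smul_def, ENNReal.smul_def, smul_eq_mul, smul_eq_mul, mul_left_comm]
  gcongr

/-- Both `Ψ ∘ A⁻¹` on `A(s)` and `A ∘ Ψ⁻¹` on `Ψ(s)` are `k`-Lipschitz, and the area of `A(s)` is
`|det A|` times that of `s`. -/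
theorem euclideanHausdorffMeasure_image_le_and_ge {G : Type*} [NormedAddCommGroup G]
    [MeasurableSpace G] [BorelSpace G] {Ψ : E2 → G} (hinj : Function.Injective Ψ)
    (A : E2 ≃L[ℝ] E2) {k : ℝ≥0} {s : Set E2}
    (h : ∀ u ∈ s, ∀ v ∈ s,
      ‖Ψ u - Ψ v‖ ≤ k * ‖A (u - v)‖ ∧ ‖A (u - v)‖ ≤ k * ‖Ψ u - Ψ v‖) :
    (μHE[2] : Measure G) (Ψ '' s) ≤
      (k : ℝ≥0∞) ^ 2 * (ENNReal.ofReal |LinearMap.det (A : E2 →ₗ[ℝ] E2)| * volume s) ∧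
    ENNReal.ofReal |LinearMap.det (A : E2 →ₗ[ℝ] E2)| * volume s ≤
      (k : ℝ≥0∞) ^ 2 * (μHE[2] : Measure G) (Ψ '' s) := by
  have hvol : (μHE[2] : Measure E2) (A '' s) =
      ENNReal.ofReal |LinearMap.det (A : E2 →ₗ[ℝ] E2)| * volume s := by
    rw [EuclideanSpace.euclideanHausdorffMeasure_eq_volume]
    exact Measure.addHaar_image_continuousLinearEquiv _ A s
  rw [← hvol]
  constructor
  · have h1 : LipschitzOnWith k (Ψ ∘ A.symm) (A '' s) := by
      refine LipschitzOnWith.of_dist_le_mul ?_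
      rintro _ ⟨u, hu, rfl⟩ _ ⟨v, hv, rfl⟩
      simpa [dist_eq_norm] using (h u hu v hv).1
    have h2 := h1.euclideanHausdorffMeasure_image_le 2
    rwa [← Set.image_comp, show (Ψ ∘ A.symm) ∘ A = Ψ by ext; simp] at h2
  · have h1 : LipschitzOnWith k (A ∘ Function.invFun Ψ) (Ψ '' s) := by
      refine LipschitzOnWith.of_dist_le_mul ?_
      rintro _ ⟨u, hu, rfl⟩ _ ⟨v, hv, rfl⟩
      simpa [dist_eq_norm, Function.leftInverse_invFun hinj _] using (h u hu v hv).2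
    have h2 := h1.euclideanHausdorffMeasure_image_le 2
    rwa [← Set.image_comp, show (A ∘ Function.invFun Ψ) ∘ Ψ = A by
      ext; simp [Function.leftInverse_invFun hinj _]] at h2

variable [MeasurableSpace F] [BorelSpace F]

/-- An inequality between measures holds if it holds for small sets. -/
theorem MeasureTheory.Measure.le_of_forall_exists_nhds {X : Type*} [TopologicalSpace X]
    [SecondCountableTopology X] [MeasurableSpace X] [OpensMeasurableSpace X] {μ ν : Measure X}
    (h : ∀ x, ∃ s ∈ 𝓝 x, ∀ t ⊆ s, MeasurableSet t → μ t ≤ ν t) : μ ≤ ν := by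
  choose s hs hle using h
  obtain ⟨c, hc, hcov⟩ := TopologicalSpace.countable_cover_nhds
    (f := fun x => interior (s x)) (fun x => interior_mem_nhds.2 (hs x))
  rcases isEmpty_or_nonempty X with hX | hX
  · exact Measure.le_iff.2 fun t _ => by simp [Set.eq_empty_of_isEmpty t]
  have hne : c.Nonempty := by
    obtain ⟨x⟩ := hX
    have : x ∈ ⋃ y ∈ c, interior (s y) := hcov ▸ Set.mem_univ x
    obtain ⟨y, hy, -⟩ := Set.mem_iUnion₂.1 this
    exact ⟨y, hy⟩
  obtain ⟨a, rfl⟩ := hc.exists_eq_range hne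
  -- The countable cover by good neighbourhoods becomes a measurable partition, over which both
  -- measures are summed.
  set d := disjointed fun n => interior (s (a n))
  have hdm : ∀ n, MeasurableSet (d n) :=
    MeasurableSet.disjointed fun n => isOpen_interior.measurableSet
  have hdu : ⋃ n, d n = Set.univ := by
    rw [iUnion_disjointed, ← hcov, Set.biUnion_range]
  refine Measure.le_iff.2 fun t ht => ?_
  have key : ∀ κ : Measure X, κ t = ∑' n, κ (t ∩ d n) := fun κ => by
    rw [← measure_iUnion _ fun n => ht.inter (hdm n), ← Set.inter_iUnion, hdu, Set.inter_univ]
    exact fun i j hij => (disjoint_disjointed _ hij).mono Set.inter_subset_right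
      Set.inter_subset_right
  rw [key μ, key ν]
  refine ENNReal.tsum_le_tsum fun n => hle (a n) _ ?_ (ht.inter (hdm n))
  exact Set.inter_subset_right.trans ((disjointed_subset _ _).trans interior_subset)

/-- Let `k` tend to `1` from above; this removes the distortion factor from local estimates. -/
theorem MeasureTheory.Measure.le_of_forall_one_lt_le_smul {X : Type*} [MeasurableSpace X]
    {μ ν : Measure X} (m : ℕ) (h : ∀ k : ℝ≥0, 1 < k → μ ≤ (k : ℝ≥0∞) ^ m • ν) : μ ≤ ν := by
  refine Measure.le_iff'.2 fun t => ?_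
  have h1 : Tendsto (fun k : ℝ≥0 => (k : ℝ≥0∞) ^ m * ν t) (𝓝[>] 1) (𝓝 (1 * ν t)) := by
    refine ENNReal.Tendsto.mul_const ?_ (Or.inl one_ne_zero)
    have : Tendsto (fun k : ℝ≥0 => (k : ℝ≥0∞) ^ m) (𝓝 1) (𝓝 (((1 : ℝ≥0) : ℝ≥0∞) ^ m)) :=
      ((ENNReal.continuous_pow m).comp ENNReal.continuous_coe).tendsto 1
    simpa using this.mono_left nhdsWithin_le_nhds
  rw [one_mul] at h1
  refine ge_of_tendsto h1 ?_
  filter_upwards [self_mem_nhdsWithin] with k hk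
  simpa using Measure.le_iff'.1 (h k hk) t

/-- The area formula for an injective `C¹` immersion of the plane. -/
theorem comap_euclideanHausdorffMeasure_eq_withDensity {Ψ : E2 → F} (hΨ : ContDiff ℝ 1 Ψ)
    (hinj : Function.Injective Ψ) (himm : ∀ u, Function.Injective (fderiv ℝ Ψ u)) :
    (μHE[2] : Measure F).comap Ψ =
      volume.withDensity fun u => ENNReal.ofReal (areaFactor (fderiv ℝ Ψ u)) := by
  have hemb : MeasurableEmbedding Ψ := hΨ.continuous.measurableEmbedding hinj
  have hJc : Continuous fun u => areaFactor (fderiv ℝ Ψ u) :=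
    continuous_areaFactor.comp (hΨ.continuous_fderiv one_ne_zero)
  -- Of the three factors `k`, two come from the Lipschitz bound in dimension two and one from the
  -- oscillation of the area factor near `x`.
  have local_bounds : ∀ k : ℝ≥0, 1 < k → ∀ x, ∃ s ∈ 𝓝 x, ∀ t ⊆ s, MeasurableSet t →
      (μHE[2] : Measure F) (Ψ '' t) ≤ (k : ℝ≥0∞) ^ 3 *
        volume.withDensity (fun u => ENNReal.ofReal (areaFactor (fderiv ℝ Ψ u))) t ∧
      volume.withDensity (fun u => ENNReal.ofReal (areaFactor (fderiv ℝ Ψ u))) t ≤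
        (k : ℝ≥0∞) ^ 3 * (μHE[2] : Measure F) (Ψ '' t) := by
    intro k hk x
    obtain ⟨A, hA⟩ := exists_continuousLinearEquiv_norm_eq _ (himm x)
    have hk' : (1 : ℝ) < k := by exact_mod_cast hk
    obtain ⟨s, hs, hbd⟩ := (hΨ.contDiffAt.hasStrictFDerivAt one_ne_zero
      (x := x)).exists_nhds_norm_sub_le A hA hk'
    have hpos := areaFactor_pos _ (himm x)
    set J := fun u => areaFactor (fderiv ℝ Ψ u) with hJ
    have h1 : ∀ᶠ u in 𝓝 x, J u < k * J x :=
      hJc.continuousAt.eventually_lt continuousAt_const (by nlinarith [hpos])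
    have h2 : ∀ᶠ u in 𝓝 x, J x < k * J u :=
      continuousAt_const.eventually_lt (continuousAt_const.mul hJc.continuousAt)
        (by nlinarith [hpos])
    refine ⟨s ∩ {u | J u < k * J x ∧ J x < k * J u}, inter_mem hs (h1.and h2),
      fun t hts ht => ?_⟩
    obtain ⟨h3, h4⟩ := euclideanHausdorffMeasure_image_le_and_ge hinj A
      (fun u hu v hv => hbd u (hts hu).1 v (hts hv).1)
    rw [abs_det_eq_areaFactor A _ hA] at h3 h4
    rw [withDensity_apply _ ht]
    have hup : ∫⁻ u in t, ENNReal.ofReal (J u) ≤ k * (ENNReal.ofReal (J x) * volume t) := by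
      rw [← mul_assoc, ← setLIntegral_const]
      refine setLIntegral_mono' ht fun u hu => ?_
      rw [← ENNReal.ofReal_coe_nnreal, ← ENNReal.ofReal_mul k.coe_nonneg]
      exact ENNReal.ofReal_le_ofReal (hts hu).2.1.le
    have hdown : ENNReal.ofReal (J x) * volume t ≤ k * ∫⁻ u in t, ENNReal.ofReal (J u) := by
      rw [← setLIntegral_const, ← lintegral_const_mul' _ _ ENNReal.coe_ne_top]
      refine setLIntegral_mono' ht fun u hu => ?_
      rw [← ENNReal.ofReal_coe_nnreal, ← ENNReal.ofReal_mul k.coe_nonneg]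
      exact ENNReal.ofReal_le_ofReal (hts hu).2.2.le
    constructor
    · calc _ ≤ _ := h3
        _ ≤ (k : ℝ≥0∞) ^ 2 * (k * ∫⁻ u in t, ENNReal.ofReal (J u)) := by gcongr
        _ = _ := by ring
    · calc _ ≤ _ := hup
        _ ≤ k * ((k : ℝ≥0∞) ^ 2 * (μHE[2] : Measure F) (Ψ '' t)) := by gcongr
        _ = _ := by ring
  apply le_antisymm
  · refine Measure.le_of_forall_one_lt_le_smul 3 fun k hk =>
      Measure.le_of_forall_exists_nhds fun x => ?_
    obtain ⟨s, hs, h⟩ := local_bounds k hk x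
    refine ⟨s, hs, fun t hts ht => ?_⟩
    simpa [hemb.comap_apply] using (h t hts ht).1
  · refine Measure.le_of_forall_one_lt_le_smul 3 fun k hk =>
      Measure.le_of_forall_exists_nhds fun x => ?_
    obtain ⟨s, hs, h⟩ := local_bounds k hk x
    refine ⟨s, hs, fun t hts ht => ?_⟩
    simpa [hemb.comap_apply] using (h t hts ht).2

end AreaFormula

/-! ### Graphs over a plane -/

section Graph

open MeasureTheory Topology Filter Set

/-- The graph of `g` in the orthonormal frame `b`, as a parametrized surface. -/
noncomputable def graphMap (b : OrthonormalBasis (Fin 3) ℝ E3) (g : E2 → ℝ) (u : E2) : E3 :=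
  u 0 • b 0 + u 1 • b 1 + g u • b 2

/-- The first two coordinates in the frame `b`. -/
noncomputable def graphProj (b : OrthonormalBasis (Fin 3) ℝ E3) : E3 →L[ℝ] E2 :=
  LinearMap.toContinuousLinearMap
    { toFun := fun x => !₂[inner ℝ (b 0) x, inner ℝ (b 1) x]
      map_add' := fun x y => by ext i; fin_cases i <;> simp [inner_add_right]
      map_smul' := fun c x => by ext i; fin_cases i <;> simp [inner_smul_right] }

/-- Partial derivatives in the plane. -/
noncomputable def pderiv (g : E2 → ℝ) (a : Fin 2) (u : E2) : ℝ :=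
  fderiv ℝ g u (EuclideanSpace.single a 1)

/-- The area element `√(1 + |∇g|²)` of a graph. -/
noncomputable def graphArea (g : E2 → ℝ) (u : E2) : ℝ :=
  √(1 + pderiv g 0 u ^ 2 + pderiv g 1 u ^ 2)

/-- The upward unit normal of a graph. -/
noncomputable def graphNormal (b : OrthonormalBasis (Fin 3) ℝ E3) (g : E2 → ℝ) (u : E2) : E3 :=
  (graphArea g u)⁻¹ • (b 2 - pderiv g 0 u • b 0 - pderiv g 1 u • b 1)

variable (b : OrthonormalBasis (Fin 3) ℝ E3) {g : E2 → ℝ}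

@[simp] theorem graphProj_apply_zero (x : E3) : graphProj b x 0 = inner ℝ (b 0) x := rfl

@[simp] theorem graphProj_apply_one (x : E3) : graphProj b x 1 = inner ℝ (b 1) x := rfl

theorem frame_expansion (x : E3) :
    x = (inner ℝ (b 0) x : ℝ) • b 0 + (inner ℝ (b 1) x : ℝ) • b 1 + (inner ℝ (b 2) x : ℝ) • b 2 := by
  conv_lhs => rw [← b.sum_repr x]
  simp [Fin.sum_univ_three, b.repr_apply_apply]

theorem inner_frame (i j : Fin 3) : inner ℝ (b i) (b j) = if i = j then (1 : ℝ) else 0 :=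
  b.inner_eq_ite i j

@[simp] theorem graphProj_graphMap (u : E2) : graphProj b (graphMap b g u) = u := by
  ext i
  fin_cases i <;> simp [graphMap]

theorem graphMap_injective : Function.Injective (graphMap b g) :=
  Function.LeftInverse.injective (graphProj_graphMap b)

theorem expand_E2 (w : E2) :
    w = w 0 • EuclideanSpace.single 0 (1 : ℝ) + w 1 • EuclideanSpace.single 1 (1 : ℝ) := by
  ext i
  fin_cases i <;> simp

theorem fderiv_apply_eq_pderiv (f : E2 → ℝ) (u w : E2) :
    fderiv ℝ f u w = w 0 * pderiv f 0 u + w 1 * pderiv f 1 u := by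
  conv_lhs => rw [expand_E2 w]
  simp [pderiv]

theorem hasFDerivAt_graphMap {u : E2} (hg : DifferentiableAt ℝ g u) :
    HasFDerivAt (graphMap b g)
      ((EuclideanSpace.proj (𝕜 := ℝ) (0 : Fin 2)).smulRight (b 0) +
        (EuclideanSpace.proj (𝕜 := ℝ) (1 : Fin 2)).smulRight (b 1) +
        (fderiv ℝ g u).smulRight (b 2)) u := by
  unfold graphMap
  exact (((EuclideanSpace.proj (𝕜 := ℝ) (0 : Fin 2)).hasFDerivAt.smul_const (b 0)).add
    ((EuclideanSpace.proj (𝕜 := ℝ) (1 : Fin 2)).hasFDerivAt.smul_const (b 1))).add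
    (hg.hasFDerivAt.smul_const (b 2))

theorem fderiv_graphMap_apply {u : E2} (hg : DifferentiableAt ℝ g u) (w : E2) :
    fderiv ℝ (graphMap b g) u w =
      w 0 • b 0 + w 1 • b 1 + (w 0 * pderiv g 0 u + w 1 * pderiv g 1 u) • b 2 := by
  rw [(hasFDerivAt_graphMap b hg).fderiv, ← fderiv_apply_eq_pderiv]
  simp

theorem contDiff_graphMap {n : WithTop ℕ∞} (hg : ContDiff ℝ n g) : ContDiff ℝ n (graphMap b g) := by
  unfold graphMap
  fun_prop

theorem contDiff_pderiv {m n : WithTop ℕ∞} {f : E2 → ℝ} (hf : ContDiff ℝ n f) (hmn : m + 1 ≤ n)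
    (a : Fin 2) : ContDiff ℝ m (pderiv f a) :=
  (hf.fderiv_right hmn).clm_apply contDiff_const

theorem graphArea_sq (g : E2 → ℝ) (u : E2) :
    graphArea g u ^ 2 = 1 + pderiv g 0 u ^ 2 + pderiv g 1 u ^ 2 :=
  Real.sq_sqrt (by positivity)

theorem graphArea_pos (g : E2 → ℝ) (u : E2) : 0 < graphArea g u :=
  Real.sqrt_pos.2 (by positivity)

theorem contDiff_graphArea (hg : ContDiff ℝ 2 g) : ContDiff ℝ 1 (graphArea g) := by
  have h := fun a => contDiff_pderiv (m := 1) hg (by norm_num) a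
  exact ContDiff.sqrt ((contDiff_const.add ((h 0).pow 2)).add ((h 1).pow 2))
    fun u => by positivity

theorem contDiff_graphNormal (hg : ContDiff ℝ 2 g) : ContDiff ℝ 1 (graphNormal b g) := by
  have h := fun a => contDiff_pderiv (m := 1) hg (by norm_num) a
  exact ((contDiff_graphArea hg).inv fun u => (graphArea_pos g u).ne').smul
    ((contDiff_const.sub ((h 0).smul contDiff_const)).sub ((h 1).smul contDiff_const))

theorem fderiv_graphMap_injective {u : E2} (hg : DifferentiableAt ℝ g u) :
    Function.Injective (fderiv ℝ (graphMap b g) u) := by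
  refine Function.LeftInverse.injective (g := graphProj b) fun w => ?_
  rw [fderiv_graphMap_apply b hg]
  ext i
  fin_cases i <;> simp

theorem areaFactor_fderiv_graphMap {u : E2} (hg : DifferentiableAt ℝ g u) :
    areaFactor (fderiv ℝ (graphMap b g) u) = graphArea g u := by
  unfold areaFactor graphArea
  congr 1
  rw [← real_inner_self_eq_norm_sq, ← real_inner_self_eq_norm_sq, fderiv_graphMap_apply b hg,
    fderiv_graphMap_apply b hg]
  simp only [inner_add_left, inner_add_right, real_inner_smul_left, real_inner_smul_right,
    inner_frame]
  simp
  ring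

theorem inner_graphNormal (u : E2) (x : E3) :
    inner ℝ (graphNormal b g u) x = (graphArea g u)⁻¹ *
      (inner ℝ (b 2) x - pderiv g 0 u * inner ℝ (b 0) x - pderiv g 1 u * inner ℝ (b 1) x) := by
  simp [graphNormal, inner_sub_left, inner_smul_left]

theorem inner_graphNormal_self (u : E2) :
    inner ℝ (graphNormal b g u) (graphNormal b g u) = (1 : ℝ) := by
  rw [inner_graphNormal]
  simp only [graphNormal, inner_sub_right, inner_smul_right, inner_frame]
  have h1 := graphArea_sq g u
  have h2 := graphArea_pos g u
  simp
  field_simp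
  linarith

/-- On the open set `U` the set `S` is the graph of the `C²` function `g` in the frame `b`. -/
structure IsGraphOn (S : Set E3) (b : OrthonormalBasis (Fin 3) ℝ E3) (g : E2 → ℝ) (U : Set E3) :
    Prop where
  contDiff : ContDiff ℝ 2 g
  isOpen : IsOpen U
  inter_eq : S ∩ U = range (graphMap b g) ∩ U

namespace IsGraphOn

variable {b} {S U K : Set E3} {n : E3 → E3} {u : E2}

theorem differentiable (h : IsGraphOn S b g U) : Differentiable ℝ g :=
  h.contDiff.differentiable (by norm_num)

theorem continuous_graphMap (h : IsGraphOn S b g U) : Continuous (graphMap b g) :=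
  (contDiff_graphMap b h.contDiff).continuous

theorem mem (h : IsGraphOn S b g U) (hu : graphMap b g u ∈ U) : graphMap b g u ∈ S := by
  have : graphMap b g u ∈ S ∩ U := h.inter_eq ▸ ⟨mem_range_self u, hu⟩
  exact this.1

theorem exists_eq (h : IsGraphOn S b g U) {x : E3} (hx : x ∈ S) (hU : x ∈ U) :
    graphMap b g (graphProj b x) = x := by
  have : x ∈ range (graphMap b g) ∩ U := h.inter_eq ▸ ⟨hx, hU⟩
  obtain ⟨u, rfl⟩ := this.1
  rw [graphProj_graphMap]

theorem isOpen_preimage (h : IsGraphOn S b g U) : IsOpen (graphMap b g ⁻¹' U) :=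
  h.isOpen.preimage h.continuous_graphMap

/-- The preimage of `U` is open, so all directions of the plane are tangent to it, and a derivative
maps tangent cones to tangent cones. -/
theorem fderiv_mem_tangentConeAt (h : IsGraphOn S b g U) (hu : graphMap b g u ∈ U) (w : E2) :
    fderiv ℝ (graphMap b g) u w ∈ tangentConeAt ℝ S (graphMap b g u) := by
  have hd := (hasFDerivAt_graphMap b (h.differentiable u)).differentiableAt.hasFDerivAt
  have h1 := (hd.hasFDerivWithinAt (s := graphMap b g ⁻¹' U)).mapsTo_tangent_cone
  rw [tangentConeAt_of_mem_nhds (h.isOpen_preimage.mem_nhds hu)] at h1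
  refine tangentConeAt_mono ?_ (h1 (mem_univ w))
  rintro _ ⟨v, hv, rfl⟩
  exact h.mem hv

/-- Orthogonality to the two coordinate tangents fixes `n` up to a factor, and `|n| = 1` makes it a
sign. The sign may change from point to point, as `n` is not assumed continuous. -/
theorem exists_eq_smul_graphNormal (h : IsGraphOn S b g U) (hn : IsUnitNormalField S n)
    (hu : graphMap b g u ∈ U) :
    ∃ c : ℝ, c ^ 2 = 1 ∧ n (graphMap b g u) = c • graphNormal b g u := by
  obtain ⟨h1, h2⟩ := hn _ (h.mem hu)
  set ν := n (graphMap b g u)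
  have e0 := h2 _ (h.fderiv_mem_tangentConeAt hu (EuclideanSpace.single 0 1))
  have e1 := h2 _ (h.fderiv_mem_tangentConeAt hu (EuclideanSpace.single 1 1))
  rw [fderiv_graphMap_apply b (h.differentiable u)] at e0 e1
  simp [inner_add_right, inner_smul_right] at e0 e1
  have hν : ν = (inner ℝ (b 2) ν * graphArea g u) • graphNormal b g u := by
    rw [graphNormal, smul_smul, mul_assoc, mul_inv_cancel₀ (graphArea_pos g u).ne', mul_one]
    conv_lhs => rw [frame_expansion b ν]
    rw [real_inner_comm ν, real_inner_comm ν, real_inner_comm ν, eq_neg_of_add_eq_zero_left e0,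
      eq_neg_of_add_eq_zero_left e1]
    module
  refine ⟨_, ?_, hν⟩
  have h3 : inner ℝ ν ν = (1 : ℝ) := by rw [real_inner_self_eq_norm_sq, h1]; norm_num
  rw [hν] at h3
  rw [inner_smul_left, inner_smul_right, inner_graphNormal_self] at h3
  simp at h3
  nlinarith

/-- The sign of `n` cancels in `n ⊗ n`, so the projection inherits the regularity of `graphNormal`.
-/
theorem surfProj_eq (h : IsGraphOn S b g U) (hn : IsUnitNormalField S n)
    (hu : graphMap b g u ∈ U) (i j : Fin 3) :
    surfProj n (graphMap b g u) i j =
      (if i = j then 1 else 0) - graphNormal b g u i * graphNormal b g u j := by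
  obtain ⟨c, hc, hcn⟩ := h.exists_eq_smul_graphNormal hn hu
  simp only [surfProj, Matrix.of_apply, hcn, PiLp.smul_apply, smul_eq_mul]
  linear_combination (-(graphNormal b g u i * graphNormal b g u j)) * hc

theorem inner_graphNormal_eq_zero (h : IsGraphOn S b g U) (hn : IsUnitNormalField S n)
    (hu : graphMap b g u ∈ U) {y : E3} (hy : inner ℝ y (n (graphMap b g u)) = 0) :
    inner ℝ (graphNormal b g u) y = 0 := by
  obtain ⟨c, hc, hcn⟩ := h.exists_eq_smul_graphNormal hn hu
  rw [hcn, inner_smul_right, real_inner_comm] at hy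
  have : c ≠ 0 := by rintro rfl; norm_num at hc
  simpa [this] using hy

/-- A vector orthogonal to `graphNormal` is tangent to the graph, and a tangent vector is the lift
of its first two frame coordinates. This turns surface derivatives into derivatives in the plane. -/
theorem projection_eq (u : E2) (x : E3) (hg : DifferentiableAt ℝ g u) :
    x - (inner ℝ (graphNormal b g u) x : ℝ) • graphNormal b g u = fderiv ℝ (graphMap b g) u
      (graphProj b (x - (inner ℝ (graphNormal b g u) x : ℝ) • graphNormal b g u)) := by
  set y := x - (inner ℝ (graphNormal b g u) x : ℝ) • graphNormal b g u with hy
  have h0 : inner ℝ (graphNormal b g u) y = (0 : ℝ) := by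
    rw [hy, inner_sub_right, inner_smul_right, inner_graphNormal_self]; ring
  rw [inner_graphNormal, mul_eq_zero_iff_left (inv_pos.2 (graphArea_pos g u)).ne'] at h0
  rw [fderiv_graphMap_apply b hg]
  conv_lhs => rw [frame_expansion b y]
  congr 2
  simp only [graphProj_apply_zero, graphProj_apply_one]
  linarith

theorem tendsto_nhdsWithin (h : IsGraphOn S b g U) (hu : graphMap b g u ∈ U) :
    Tendsto (graphMap b g) (𝓝 u) (𝓝[S] (graphMap b g u)) :=
  tendsto_nhdsWithin_iff.2 ⟨h.continuous_graphMap.continuousAt,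
    mem_of_superset (h.isOpen_preimage.mem_nhds hu) fun _ hv => h.mem hv⟩

theorem hasFDerivAt_comp {E : Type*} [NormedAddCommGroup E] [NormedSpace ℝ E] {f : E3 → E}
    {f' : E3 →L[ℝ] E} (h : IsGraphOn S b g U) (hu : graphMap b g u ∈ U)
    (hf : HasFDerivWithinAt f f' S (graphMap b g u)) :
    HasFDerivAt (fun v => f (graphMap b g v)) (f' ∘L fderiv ℝ (graphMap b g) u) u := by
  have hd := (hasFDerivAt_graphMap b (h.differentiable u)).differentiableAt.hasFDerivAt
  rw [← hasFDerivWithinAt_univ]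
  refine HasFDerivWithinAt.comp_of_tendsto u hf hd.hasFDerivWithinAt ?_
  rw [nhdsWithin_univ]
  exact h.tendsto_nhdsWithin hu

theorem surfDeriv_eq (h : IsGraphOn S b g U) (hn : IsUnitNormalField S n)
    (hu : graphMap b g u ∈ U) {f : E3 → ℝ}
    (hf : DifferentiableWithinAt ℝ f S (graphMap b g u)) (i : Fin 3) :
    surfDeriv S n i f (graphMap b g u) =
      fderiv ℝ (fun v => f (graphMap b g v)) u (graphProj b (EuclideanSpace.single i 1 -
        (inner ℝ (graphNormal b g u) (EuclideanSpace.single i 1) : ℝ) • graphNormal b g u)) := by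
  rw [(h.hasFDerivAt_comp hu hf.hasFDerivWithinAt).fderiv, ContinuousLinearMap.comp_apply,
    ← projection_eq u _ (h.differentiable u)]
  unfold surfDeriv
  congr 1
  ext j
  simp only [h.surfProj_eq hn hu]
  simp [EuclideanSpace.inner_single_right, eq_comm]

/-- The surface divergence is the trace of the derivative of `Y` composed with the tangential
projection, so it may be computed in the frame `b` instead of the standard basis. -/
theorem surfDiv_eq (h : IsGraphOn S b g U) (hn : IsUnitNormalField S n)
    (hu : graphMap b g u ∈ U) {Y : E3 → E3}
    (hY : DifferentiableWithinAt ℝ Y S (graphMap b g u)) :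
    surfDiv S n Y (graphMap b g u) =
      ∑ k, fderiv ℝ (fun v => inner ℝ (b k) (Y (graphMap b g v))) u (graphProj b (b k -
        (inner ℝ (graphNormal b g u) (b k) : ℝ) • graphNormal b g u)) := by
  set N := graphNormal b g u
  have hZ := h.hasFDerivAt_comp hu hY.hasFDerivWithinAt
  set Z' := fderivWithin ℝ Y S (graphMap b g u) ∘L fderiv ℝ (graphMap b g) u
  let T : E3 →L[ℝ] E3 := Z' ∘L graphProj b ∘L
    (ContinuousLinearMap.id ℝ E3 - (innerSL ℝ N).smulRight N)
  have key : ∀ c : OrthonormalBasis (Fin 3) ℝ E3,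
      LinearMap.trace ℝ E3 (T : E3 →ₗ[ℝ] E3) =
        ∑ k, fderiv ℝ (fun v => inner ℝ (c k) (Y (graphMap b g v))) u
          (graphProj b (c k - (inner ℝ N (c k) : ℝ) • N)) := fun c => by
    rw [LinearMap.trace_eq_sum_inner _ c]
    refine Finset.sum_congr rfl fun k _ => ?_
    have hc : HasFDerivAt (fun v => (inner ℝ (c k) (Y (graphMap b g v)) : ℝ))
      (innerSL ℝ (c k) ∘L Z') u := (innerSL ℝ (c k)).hasFDerivAt.comp u hZ
    rw [hc.fderiv]
    rfl
  rw [← key b, key (EuclideanSpace.basisFun (Fin 3) ℝ)]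
  unfold surfDiv
  refine Finset.sum_congr rfl fun j _ => ?_
  rw [h.surfDeriv_eq hn hu (f := fun y => Y y j)
    ((EuclideanSpace.proj (𝕜 := ℝ) j).differentiableAt.comp_differentiableWithinAt _ hY)]
  simp [EuclideanSpace.inner_single_left, N]

end IsGraphOn

theorem hasFDerivAt_pderiv (hg : ContDiff ℝ 2 g) (u : E2) (a : Fin 2) :
    HasFDerivAt (pderiv g a) ((fderiv ℝ (fderiv ℝ g) u).flip (EuclideanSpace.single a 1)) u := by
  have h1 : DifferentiableAt ℝ (fderiv ℝ g) u :=
    (hg.fderiv_right (m := 1) (by norm_num)).differentiable one_ne_zero u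
  change HasFDerivAt (fun v => fderiv ℝ g v (EuclideanSpace.single a 1)) _ u
  simpa using h1.hasFDerivAt.clm_apply (hasFDerivAt_const (EuclideanSpace.single a (1 : ℝ)) u)

theorem pderiv_pderiv_comm (hg : ContDiff ℝ 2 g) (u : E2) :
    pderiv (pderiv g 0) 1 u = pderiv (pderiv g 1) 0 u := by
  have h := (hg.contDiffAt (x := u)).isSymmSndFDerivAt (by simp)
  rw [pderiv, (hasFDerivAt_pderiv hg u 0).fderiv, pderiv, (hasFDerivAt_pderiv hg u 1).fderiv]
  exact h _ _

/-- Differentiate `J² = 1 + |∇g|²`. -/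
theorem graphArea_mul_pderiv_graphArea (hg : ContDiff ℝ 2 g) (u : E2) (a : Fin 2) :
    graphArea g u * pderiv (graphArea g) a u =
      pderiv g 0 u * pderiv (pderiv g 0) a u + pderiv g 1 u * pderiv (pderiv g 1) a u := by
  have hJ := ((contDiff_graphArea hg).differentiable one_ne_zero u).hasFDerivAt
  have h := fun c => ((hasFDerivAt_pderiv hg u c).differentiableAt).hasFDerivAt
  have h1 : HasFDerivAt (fun v => graphArea g v ^ 2) _ u := hJ.pow 2
  have h2 := (((hasFDerivAt_const (1 : ℝ) u).add ((h 0).pow 2)).add ((h 1).pow 2))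
  have h3 : (fun v => graphArea g v ^ 2) =
      (((fun _ => (1 : ℝ)) + pderiv g 0 ^ 2) + pderiv g 1 ^ 2) := by
    ext v; simp [graphArea_sq]
  rw [h3] at h1
  have h4 := congrArg (fun L => L (EuclideanSpace.single a 1)) (h1.unique h2)
  simp at h4
  simp only [pderiv] at h4 ⊢
  linarith

namespace IsGraphOn

variable {b} {S U K : Set E3} {n : E3 → E3} {u : E2}

/-- In a graph chart the surface divergence of a tangential field is a divergence in the plane. -/
theorem graphArea_mul_surfDiv (h : IsGraphOn S b g U) (hn : IsUnitNormalField S n)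
    (hu : graphMap b g u ∈ U) {Y : E3 → E3}
    (hY : DifferentiableWithinAt ℝ Y S (graphMap b g u))
    (htan : ∀ x ∈ S, inner ℝ (Y x) (n x) = 0) :
    graphArea g u * surfDiv S n Y (graphMap b g u) =
      pderiv (fun v => graphArea g v * inner ℝ (b 0) (Y (graphMap b g v))) 0 u +
      pderiv (fun v => graphArea g v * inner ℝ (b 1) (Y (graphMap b g v))) 1 u := by
  have hg := h.contDiff
  have hZ := h.hasFDerivAt_comp hu hY.hasFDerivWithinAt
  have hy : ∀ k, DifferentiableAt ℝ (fun v => (inner ℝ (b k) (Y (graphMap b g v)) : ℝ)) u :=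
    fun k => ((innerSL ℝ (b k)).hasFDerivAt.comp u hZ).differentiableAt
  have hJ := (contDiff_graphArea hg).differentiable one_ne_zero u
  have hp := fun c => (hasFDerivAt_pderiv hg u c).differentiableAt
  rw [h.surfDiv_eq hn hu hY]
  set y : Fin 3 → E2 → ℝ := fun k v => inner ℝ (b k) (Y (graphMap b g v)) with hydef
  change graphArea g u * ∑ k, fderiv ℝ (y k) u _ =
    pderiv (fun v => graphArea g v * y 0 v) 0 u + pderiv (fun v => graphArea g v * y 1 v) 1 u
  have hmul : ∀ k a, pderiv (fun v => graphArea g v * y k v) a u =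
      graphArea g u * pderiv (y k) a u + pderiv (graphArea g) a u * y k u := fun k a => by
    have := (hJ.hasFDerivAt.mul (hy k).hasFDerivAt).fderiv
    change fderiv ℝ (fun v => graphArea g v * y k v) u = _ at this
    simp only [pderiv]
    rw [this]
    simp [mul_comm, y]
  -- Tangency determines the third coordinate from the first two; it holds near `u`, so it can be
  -- differentiated.
  have hy2 : y 2 =ᶠ[𝓝 u] fun v => pderiv g 0 v * y 0 v + pderiv g 1 v * y 1 v := by
    filter_upwards [h.isOpen_preimage.mem_nhds hu] with v hv
    have := h.inner_graphNormal_eq_zero hn hv (htan _ (h.mem hv))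
    rw [inner_graphNormal, mul_eq_zero_iff_left (inv_pos.2 (graphArea_pos g v)).ne'] at this
    simp only [hydef]
    linarith
  have hdy2 : ∀ a, pderiv (y 2) a u = pderiv (pderiv g 0) a u * y 0 u +
      pderiv g 0 u * pderiv (y 0) a u + (pderiv (pderiv g 1) a u * y 1 u +
      pderiv g 1 u * pderiv (y 1) a u) := fun a => by
    have h1 := (((hp 0).hasFDerivAt.mul (hy 0).hasFDerivAt).add
      ((hp 1).hasFDerivAt.mul (hy 1).hasFDerivAt)).fderiv
    have h2 := hy2.fderiv_eq (𝕜 := ℝ)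
    change fderiv ℝ (fun v => pderiv g 0 v * y 0 v + pderiv g 1 v * y 1 v) u = _ at h1
    have h3 : pderiv (y 2) a u = _ := congrArg (fun L => L (EuclideanSpace.single a 1)) (h2.trans h1)
    rw [h3]
    simp [pderiv, mul_comm, y]
    ring
  have hN : ∀ k, fderiv ℝ (y k) u (graphProj b (b k -
      (inner ℝ (graphNormal b g u) (b k) : ℝ) • graphNormal b g u)) =
      (inner ℝ (b 0) (b k) - inner ℝ (graphNormal b g u) (b k) *
        inner ℝ (graphNormal b g u) (b 0)) * pderiv (y k) 0 u +
      (inner ℝ (b 1) (b k) - inner ℝ (graphNormal b g u) (b k) *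
        inner ℝ (graphNormal b g u) (b 1)) * pderiv (y k) 1 u := fun k => by
    rw [fderiv_apply_eq_pderiv, graphProj_apply_zero, graphProj_apply_one, inner_sub_right,
      inner_sub_right, inner_smul_right, inner_smul_right, real_inner_comm (b 0),
      real_inner_comm (b 1)]
  rw [hmul, hmul, Fin.sum_univ_three, hN, hN, hN, hdy2, hdy2]
  simp only [inner_graphNormal, inner_frame]
  have hA := graphArea_sq g u
  have hA0 := graphArea_pos g u
  have hA1 := graphArea_mul_pderiv_graphArea hg u 0
  have hA2 := graphArea_mul_pderiv_graphArea hg u 1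
  rw [← pderiv_pderiv_comm hg u] at hA1
  have e0 : pderiv (graphArea g) 0 u = (pderiv g 0 u * pderiv (pderiv g 0) 0 u +
    pderiv g 1 u * pderiv (pderiv g 0) 1 u) / graphArea g u := by
    field_simp; linarith
  have e1 : pderiv (graphArea g) 1 u = (pderiv g 0 u * pderiv (pderiv g 0) 1 u +
    pderiv g 1 u * pderiv (pderiv g 1) 1 u) / graphArea g u := by
    field_simp; linarith
  rw [e0, e1, ← pderiv_pderiv_comm hg u]
  -- With the second derivatives of `g` symmetric, what remains is a rational identity in the
  -- derivatives and in `J`, subject only to `J² = 1 + |∇g|²`.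
  generalize graphArea g u = J at *
  simp
  field_simp
  rw [hA]
  ring

end IsGraphOn

end Graph

/-! ### Integration in a graph chart -/

section GraphIntegral

open MeasureTheory Topology Filter Set

/-- Integration by parts against the constant `1`. -/
theorem integral_pderiv_eq_zero {f : E2 → ℝ} (hf : ContDiff ℝ 1 f) (hc : HasCompactSupport f)
    (a : Fin 2) : ∫ u, pderiv f a u = 0 := by
  have h := integral_mul_fderiv_eq_neg_fderiv_mul_of_integrable (μ := (volume : Measure E2))
    (f := fun _ : E2 => (1 : ℝ)) (g := f) (v := EuclideanSpace.single a 1) (by simp)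
    (by
      simp only [one_mul]
      exact ((hf.continuous_fderiv one_ne_zero).clm_apply continuous_const).integrable_of_hasCompactSupport
        ((hc.fderiv ℝ).comp_left (g := fun L : E2 →L[ℝ] ℝ => L (EuclideanSpace.single a 1)) rfl))
    (by simpa using hf.continuous.integrable_of_hasCompactSupport hc)
    (fun x _ => differentiableAt_const _) (fun x _ => hf.differentiable one_ne_zero x)
  simpa [pderiv] using h

namespace IsGraphOn

variable {b : OrthonormalBasis (Fin 3) ℝ E3} {g : E2 → ℝ} {S U K : Set E3} {n : E3 → E3} {u : E2}

theorem measurableEmbedding (h : IsGraphOn S b g U) : MeasurableEmbedding (graphMap b g) :=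
  h.continuous_graphMap.measurableEmbedding (graphMap_injective b)

theorem measure_restrict_range (h : IsGraphOn S b g U) :
    (μHE[2] : Measure E3).restrict (range (graphMap b g)) =
      (volume.withDensity fun u => ENNReal.ofReal (graphArea g u)).map (graphMap b g) := by
  rw [← h.measurableEmbedding.map_comap, comap_euclideanHausdorffMeasure_eq_withDensity
    ((contDiff_graphMap b h.contDiff).of_le (by norm_num)) (graphMap_injective b)
    fun u => fderiv_graphMap_injective b (h.differentiable u)]
  simp only [areaFactor_fderiv_graphMap b (h.differentiable _)]

theorem setIntegral_eq (h : IsGraphOn S b g U) (f : E3 → ℝ) :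
    ∫ x in S ∩ U, f x ∂μHE[2] =
      ∫ u in graphMap b g ⁻¹' U, graphArea g u * f (graphMap b g u) := by
  rw [h.inter_eq, inter_comm, ← Measure.restrict_restrict h.isOpen.measurableSet,
    h.measure_restrict_range, h.measurableEmbedding.setIntegral_map,
    setIntegral_withDensity_eq_setIntegral_toReal_smul]
  · refine setIntegral_congr_fun h.isOpen_preimage.measurableSet fun u _ => ?_
    simp [ENNReal.toReal_ofReal (graphArea_pos g u).le]
  · exact (contDiff_graphArea h.contDiff).continuous.measurable.ennreal_ofReal
  · exact ae_of_all _ fun _ => ENNReal.ofReal_lt_top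
  · exact h.isOpen_preimage.measurableSet

/-- The continuous left inverse `graphProj` confines the closed preimage to the compact image of
`K`. -/
theorem isCompact_preimage (h : IsGraphOn S b g U) (hK : IsCompact K) :
    IsCompact (graphMap b g ⁻¹' K) := by
  refine (hK.image (graphProj b).continuous).of_isClosed_subset
    (hK.isClosed.preimage h.continuous_graphMap) fun u hu => ⟨_, hu, graphProj_graphMap b u⟩

theorem measure_inter_lt_top (h : IsGraphOn S b g U) (hK : IsCompact K) (hKU : K ⊆ U) :
    (μHE[2] : Measure E3) (S ∩ K) < ⊤ := by
  have hsub : S ∩ K ⊆ K ∩ range (graphMap b g) := fun x hx =>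
    ⟨hx.2, (h.inter_eq ▸ ⟨hx.1, hKU hx.2⟩ : x ∈ range (graphMap b g) ∩ U).1⟩
  refine (measure_mono hsub).trans_lt ?_
  have hc := h.isCompact_preimage hK
  rw [← Measure.restrict_apply hK.measurableSet, h.measure_restrict_range,
    h.measurableEmbedding.map_apply, withDensity_apply _ hc.measurableSet]
  exact ((contDiff_graphArea h.contDiff).continuous.continuousOn.integrableOn_compact
    hc).lintegral_lt_top

/-- Near `x` the projection agrees on `S` with a `C¹` function on the whole space, obtained by
composing the formula for `graphNormal` with `graphProj`. -/
theorem contDiffWithinAt_surfProj (h : IsGraphOn S b g U) (hn : IsUnitNormalField S n) {x : E3}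
    (hx : x ∈ S) (hU : x ∈ U) (i j : Fin 3) :
    ContDiffWithinAt ℝ 1 (fun y => surfProj n y i j) S x := by
  have h1 : ∀ k : Fin 3, ContDiff ℝ 1 fun y : E3 => graphNormal b g (graphProj b y) k := fun k =>
    (contDiff_euclidean.1 (contDiff_graphNormal b h.contDiff) k).comp (graphProj b).contDiff
  have h2 : ContDiff ℝ 1 fun y : E3 => (if i = j then (1 : ℝ) else 0) -
      graphNormal b g (graphProj b y) i * graphNormal b g (graphProj b y) j :=
    contDiff_const.sub ((h1 i).mul (h1 j))
  have key : ∀ y ∈ S, y ∈ U → surfProj n y i j = (if i = j then (1 : ℝ) else 0) -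
      graphNormal b g (graphProj b y) i * graphNormal b g (graphProj b y) j := fun y hy hyU => by
    have e := h.exists_eq hy hyU
    rw [← h.surfProj_eq hn (by rwa [e]), e]
  refine h2.contDiffWithinAt.congr_of_eventuallyEq ?_ (key x hx hU)
  filter_upwards [self_mem_nhdsWithin, mem_nhdsWithin_of_mem_nhds (h.isOpen.mem_nhds hU)] with
    y hy hyU using key y hy hyU

/-- Derivatives within `S` are determined only on tangent vectors; the rows of `P_Γ` are such
vectors, which makes `surfDeriv` independent of the derivative chosen. -/
theorem exists_mem_tangentConeAt (h : IsGraphOn S b g U) (hn : IsUnitNormalField S n) {x : E3}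
    (hx : x ∈ S) (hU : x ∈ U) (i : Fin 3) :
    (WithLp.toLp 2 fun j => surfProj n x i j) ∈ tangentConeAt ℝ S x := by
  have e := h.exists_eq hx hU
  set u := graphProj b x
  have hu : graphMap b g u ∈ U := by rwa [e]
  rw [← e]
  convert! h.fderiv_mem_tangentConeAt hu _ using 1
  rotate_left
  · exact graphProj b (EuclideanSpace.single i 1 -
        (inner ℝ (graphNormal b g u) (EuclideanSpace.single i 1) : ℝ) • graphNormal b g u)
  rw [← projection_eq u _ (h.differentiable u)]
  ext j
  simp only [h.surfProj_eq hn hu]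
  simp [EuclideanSpace.inner_single_right, eq_comm]

/-- The surface divergence theorem for tangential fields supported in a graph chart. -/
theorem integral_surfDiv_eq_zero (h : IsGraphOn S b g U) (hS : MeasurableSet S)
    (hn : IsUnitNormalField S n)
    (hK : IsCompact K) (hKU : K ⊆ U) {Y : E3 → E3} (hY : ContDiffOn ℝ 1 Y S)
    (hYK : ∀ x ∉ K, Y x = 0) (htan : ∀ x ∈ S, inner ℝ (Y x) (n x) = 0) :
    ∫ x in S, surfDiv S n Y x ∂μHE[2] = 0 := by
  have hzero : ∀ x ∉ K, surfDiv S n Y x = 0 := fun x hx => by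
    refine Finset.sum_eq_zero fun j _ => ?_
    have : (fun y => Y y j) =ᶠ[𝓝 x] fun _ => 0 := by
      filter_upwards [hK.isClosed.isOpen_compl.mem_nhds hx] with y hy
      simp [hYK y hy]
    have h2 := (this.filter_mono nhdsWithin_le_nhds).fderivWithin_eq (𝕜 := ℝ) (s := S)
      this.self_of_nhds
    simp [surfDeriv, h2]
  -- The graph lies in `S` only inside `U`. Outside the preimage of `U` the field vanishes nearby,
  -- because `K` is closed and contained in `U`.
  have hf : ∀ k, ContDiff ℝ 1 fun v => graphArea g v * inner ℝ (b k) (Y (graphMap b g v)) := by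
    intro k
    rw [contDiff_iff_contDiffAt]
    intro v
    by_cases hv : graphMap b g v ∈ U
    · have h1 : ContDiffWithinAt ℝ 1 (fun v => Y (graphMap b g v)) (graphMap b g ⁻¹' U) v :=
        (hY _ (h.mem hv)).comp v ((contDiff_graphMap b h.contDiff).of_le
          (by norm_num)).contDiffWithinAt fun w hw => h.mem hw
      exact (contDiff_graphArea h.contDiff).contDiffAt.mul
        (contDiffAt_const.inner ℝ (h1.contDiffAt (h.isOpen_preimage.mem_nhds hv)))
    · refine (contDiffAt_const (c := (0 : ℝ))).congr_of_eventuallyEq ?_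
      filter_upwards [(hK.isClosed.isOpen_compl.preimage h.continuous_graphMap).mem_nhds
        (fun hvK => hv (hKU hvK))] with w hw
      simp [hYK _ hw]
  have hsupp : ∀ k, HasCompactSupport fun v =>
      graphArea g v * inner ℝ (b k) (Y (graphMap b g v)) := fun k =>
    HasCompactSupport.intro (h.isCompact_preimage hK) fun v hv => by simp [hYK _ hv]
  have hint : ∀ k a, Integrable (pderiv
      (fun v => graphArea g v * inner ℝ (b k) (Y (graphMap b g v))) a) := fun k a =>
    (contDiff_pderiv (m := 0) (hf k) (by simp) a).continuous.integrable_of_hasCompactSupport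
      (((hsupp k).fderiv ℝ).comp_left
        (g := fun L : E2 →L[ℝ] ℝ => L (EuclideanSpace.single a 1)) rfl)
  have hout : ∀ k a v, v ∉ graphMap b g ⁻¹' U → pderiv
      (fun v => graphArea g v * inner ℝ (b k) (Y (graphMap b g v))) a v = 0 := by
    intro k a v hv
    have : (fun v => graphArea g v * inner ℝ (b k) (Y (graphMap b g v))) =ᶠ[𝓝 v]
        fun _ => (0 : ℝ) := by
      filter_upwards [(hK.isClosed.isOpen_compl.preimage h.continuous_graphMap).mem_nhds
        (fun hvK => hv (hKU hvK))] with w hw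
      simp [hYK _ hw]
    simp [pderiv, this.fderiv_eq]
  calc ∫ x in S, surfDiv S n Y x ∂μHE[2]
      = ∫ x in S ∩ U, surfDiv S n Y x ∂μHE[2] := by
        refine (setIntegral_eq_of_subset_of_forall_sdiff_eq_zero hS inter_subset_left
          fun x hx => hzero x fun hxK => hx.2 ⟨hx.1, hKU hxK⟩)
    _ = ∫ u in graphMap b g ⁻¹' U,
          (pderiv (fun v => graphArea g v * inner ℝ (b 0) (Y (graphMap b g v))) 0 u +
          pderiv (fun v => graphArea g v * inner ℝ (b 1) (Y (graphMap b g v))) 1 u) := by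
        rw [h.setIntegral_eq]
        refine setIntegral_congr_fun h.isOpen_preimage.measurableSet fun u hu => ?_
        exact h.graphArea_mul_surfDiv hn hu ((hY _ (h.mem hu)).differentiableWithinAt one_ne_zero)
          htan
    _ = ∫ u, (pderiv (fun v => graphArea g v * inner ℝ (b 0) (Y (graphMap b g v))) 0 u +
          pderiv (fun v => graphArea g v * inner ℝ (b 1) (Y (graphMap b g v))) 1 u) :=
        setIntegral_eq_integral_of_forall_compl_eq_zero fun v hv => by
          rw [hout 0 0 v hv, hout 1 1 v hv, add_zero]
    _ = 0 := by
        rw [integral_add (hint 0 0) (hint 1 1), integral_pderiv_eq_zero (hf 0) (hsupp 0),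
          integral_pderiv_eq_zero (hf 1) (hsupp 1), add_zero]

end IsGraphOn

/-! ### Graph charts of a `C²`-surface -/

/-- The defining function has a nonzero partial derivative at `x₀`; with that direction placed last
in the frame, the implicit function theorem solves for the height. A cutoff makes the height
function globally `C²`. -/
theorem IsC2Surface.exists_isGraphOn {S : Set E3} (hS : IsC2Surface S) {x₀ : E3} (hx₀ : x₀ ∈ S) :
    ∃ (b : OrthonormalBasis (Fin 3) ℝ E3) (g : E2 → ℝ) (U : Set E3),
      IsGraphOn S b g U ∧ x₀ ∈ U := by
  obtain ⟨r, hr, f, hf, hSf, hdf⟩ := hS x₀ hx₀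
  have hB : Metric.ball x₀ r ∈ 𝓝 x₀ := Metric.ball_mem_nhds x₀ hr
  have hfx₀ : f x₀ = 0 := by
    have : x₀ ∈ S ∩ Metric.ball x₀ r := ⟨hx₀, Metric.mem_ball_self hr⟩
    rw [hSf] at this
    exact this.2
  have hfc : ContDiffAt ℝ 2 f x₀ := hf.contDiffAt hB
  obtain ⟨b, hb⟩ : ∃ b : OrthonormalBasis (Fin 3) ℝ E3, fderiv ℝ f x₀ (b 2) ≠ 0 := by
    by_contra! hall
    refine hdf x₀ (Metric.mem_ball_self hr) ?_
    refine ContinuousLinearMap.ext fun x => ?_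
    rw [← (EuclideanSpace.basisFun (Fin 3) ℝ).sum_repr x]
    simp only [map_sum, map_smul, zero_apply]
    refine Finset.sum_congr rfl fun i _ => ?_
    -- Swapping `i` with `2` puts the `i`-th standard vector in the last position.
    have := hall ((EuclideanSpace.basisFun (Fin 3) ℝ).reindex (Equiv.swap i 2))
    rw [OrthonormalBasis.reindex_apply, Equiv.symm_swap, Equiv.swap_apply_right] at this
    rw [this]
  let Q : E2 × ℝ →L[ℝ] E3 :=
    ((EuclideanSpace.proj (𝕜 := ℝ) (0 : Fin 2)).smulRight (b 0) +
      (EuclideanSpace.proj (𝕜 := ℝ) (1 : Fin 2)).smulRight (b 1)).comp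
        (ContinuousLinearMap.fst ℝ E2 ℝ) + (ContinuousLinearMap.snd ℝ E2 ℝ).smulRight (b 2)
  let R : E3 →L[ℝ] E2 × ℝ := (graphProj b).prod (innerSL ℝ (b 2))
  have hQ : ∀ p, Q p = p.1 0 • b 0 + p.1 1 • b 1 + p.2 • b 2 := fun p => rfl
  have hQR : ∀ x, Q (R x) = x := fun x => (frame_expansion b x).symm
  have hcd : ContDiffAt ℝ 2 (f ∘ Q) (R x₀) :=
    ContDiffAt.comp _ (by rwa [hQR]) Q.contDiff.contDiffAt
  have hinv : (fderiv ℝ (f ∘ Q) (R x₀) ∘L .inr ℝ E2 ℝ).IsInvertible := by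
    have hd : fderiv ℝ (f ∘ Q) (R x₀) = fderiv ℝ f x₀ ∘L Q := by
      rw [fderiv_comp _ (by rw [hQR]; exact hfc.differentiableAt (by norm_num))
        Q.differentiableAt, hQR, Q.fderiv]
    refine ⟨ContinuousLinearEquiv.unitsEquivAut ℝ (Units.mk0 _ hb), ?_⟩
    ext
    simp [hd, hQ]
  have hpos : (2 : WithTop ℕ∞) ≠ 0 := by norm_num
  set g₀ := hcd.implicitFunction hpos hinv
  have hg₀ : ContDiffAt ℝ 2 g₀ (graphProj b x₀) := hcd.contDiffAt_implicitFunction hpos hinv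
  have hiff := hcd.eventually_apply_eq_iff_implicitFunction hpos hinv
  obtain ⟨W, hW, hgW⟩ := hg₀.contDiffOn le_rfl (by simp)
  obtain ⟨ε, hε, hεW⟩ := Metric.nhds_basis_ball.mem_iff.1 (interior_mem_nhds.2 hW)
  -- The bump equals `1` near the centre, so the graph there is unchanged, and its support stays
  -- where `g₀` is `C²`.
  let β : ContDiffBump (graphProj b x₀) := ⟨ε / 4, ε / 2, by positivity, by linarith⟩
  have hgc : ContDiff ℝ 2 fun u => β u * g₀ u := by
    rw [contDiff_iff_contDiffAt]
    intro u
    by_cases hu : u ∈ Metric.ball (graphProj b x₀) ε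
    · exact β.contDiffAt.mul (hgW.contDiffAt (mem_interior_iff_mem_nhds.1 (hεW hu)))
    · have : u ∉ tsupport β := by
        rw [β.tsupport_eq]
        intro hu'
        exact hu (Metric.closedBall_subset_ball (by change ε / 2 < ε; linarith) hu')
      refine (contDiffAt_const (c := (0 : ℝ))).congr_of_eventuallyEq ?_
      filter_upwards [notMem_tsupport_iff_eventuallyEq.1 this] with v hv
      simp [hv]
  have hev : ∀ᶠ x in 𝓝 x₀, x ∈ Metric.ball x₀ r ∧ (f x = 0 ↔
      β (graphProj b x) * g₀ (graphProj b x) = inner ℝ (b 2) x) := by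
    have h1 : ∀ᶠ x in 𝓝 x₀, β (graphProj b x) = 1 :=
      (graphProj b).continuous.continuousAt.eventually (β.eventuallyEq_one)
    have h2 := R.continuous.continuousAt.eventually hiff
    filter_upwards [h1, h2, hB] with x hx1 hx2 hx3
    refine ⟨hx3, ?_⟩
    simp only [Function.comp_apply, hQR, hfx₀] at hx2
    rw [hx1, one_mul]
    exact hx2
  -- `U` is the open set of points near which the zero set of `f` coincides with the graph.
  refine ⟨b, fun u => β u * g₀ u, interior {x | x ∈ Metric.ball x₀ r ∧ (f x = 0 ↔
      β (graphProj b x) * g₀ (graphProj b x) = inner ℝ (b 2) x)}, ⟨hgc, isOpen_interior, ?_⟩,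
    mem_interior_iff_mem_nhds.2 hev⟩
  ext x
  refine and_congr_left fun hx => ?_
  obtain ⟨hxB, hxf⟩ := interior_subset hx
  have h1 : x ∈ S ↔ f x = 0 := by
    have : x ∈ S ∩ Metric.ball x₀ r ↔ x ∈ {x | x ∈ Metric.ball x₀ r ∧ f x = 0} := by rw [hSf]
    simpa [Metric.mem_ball.1 hxB] using this
  rw [h1, hxf]
  constructor
  · intro he
    refine ⟨graphProj b x, ?_⟩
    conv_rhs => rw [frame_expansion b x]
    rw [graphMap, he]
    rfl
  · rintro ⟨u, rfl⟩
    rw [graphProj_graphMap]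
    simp [graphMap, inner_add_right, inner_smul_right]

end GraphIntegral

/-! ### Calculus on a closed `C²`-surface -/

section ClosedSurface

open MeasureTheory Topology Filter Set

variable {S : Set E3} {n : E3 → E3}

theorem IsC2Surface.contDiffOn_surfProj (hS : IsC2Surface S) (hn : IsUnitNormalField S n)
    (i j : Fin 3) : ContDiffOn ℝ 1 (fun x => surfProj n x i j) S := fun x hx => by
  obtain ⟨b, g, U, h, hU⟩ := hS.exists_isGraphOn hx
  exact h.contDiffWithinAt_surfProj hn hx hU i j

/-- Any two derivatives within `S` agree on tangent vectors. The sum and product rules for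
`surfDeriv` rest on this. -/
theorem IsC2Surface.surfDeriv_eq (hS : IsC2Surface S) (hn : IsUnitNormalField S n) {x : E3}
    (hx : x ∈ S) {f : E3 → ℝ} {f' : E3 →L[ℝ] ℝ} (hf : HasFDerivWithinAt f f' S x) (i : Fin 3) :
    surfDeriv S n i f x = f' (WithLp.toLp 2 fun j => surfProj n x i j) := by
  obtain ⟨b, g, U, h, hU⟩ := hS.exists_isGraphOn hx
  exact hf.differentiableWithinAt.hasFDerivWithinAt.unique_on hf
    (h.exists_mem_tangentConeAt hn hx hU i)

theorem surfDeriv_congr {f₁ f₂ : E3 → ℝ} (h : ∀ x ∈ S, f₁ x = f₂ x) {x : E3} (hx : x ∈ S)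
    (i : Fin 3) : surfDeriv S n i f₁ x = surfDeriv S n i f₂ x := by
  rw [surfDeriv, surfDeriv, fderivWithin_congr h (h x hx)]

theorem IsC2Surface.surfDeriv_sum (hS : IsC2Surface S) (hn : IsUnitNormalField S n) {x : E3}
    (hx : x ∈ S) {ι : Type*} (s : Finset ι) {f : ι → E3 → ℝ}
    (hf : ∀ k ∈ s, DifferentiableWithinAt ℝ (f k) S x) (i : Fin 3) :
    surfDeriv S n i (fun y => ∑ k ∈ s, f k y) x = ∑ k ∈ s, surfDeriv S n i (f k) x := by
  rw [hS.surfDeriv_eq hn hx (HasFDerivWithinAt.fun_sum fun k hk => (hf k hk).hasFDerivWithinAt)]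
  simp [surfDeriv]

theorem IsC2Surface.surfDeriv_mul (hS : IsC2Surface S) (hn : IsUnitNormalField S n) {x : E3}
    (hx : x ∈ S) {f₁ f₂ : E3 → ℝ} (h₁ : DifferentiableWithinAt ℝ f₁ S x)
    (h₂ : DifferentiableWithinAt ℝ f₂ S x) (i : Fin 3) :
    surfDeriv S n i (fun y => f₁ y * f₂ y) x =
      surfDeriv S n i f₁ x * f₂ x + f₁ x * surfDeriv S n i f₂ x := by
  rw [hS.surfDeriv_eq hn hx (h₁.hasFDerivWithinAt.fun_mul h₂.hasFDerivWithinAt)]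
  simp only [surfDeriv, add_apply, smul_apply, smul_eq_mul]
  ring

theorem IsC2Surface.surfDeriv_eq_sum (hS : IsC2Surface S) (hn : IsUnitNormalField S n) {x : E3}
    (hx : x ∈ S) {f : E3 → ℝ} (hf : DifferentiableAt ℝ f x) (i : Fin 3) :
    surfDeriv S n i f x = ∑ k, surfProj n x i k * fderiv ℝ f x (EuclideanSpace.single k 1) := by
  rw [hS.surfDeriv_eq hn hx hf.hasFDerivAt.hasFDerivWithinAt]
  have : (WithLp.toLp 2 fun j => surfProj n x i j : E3) =
      ∑ k, surfProj n x i k • EuclideanSpace.single k (1 : ℝ) := by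
    ext j
    simp [Finset.sum_apply, Pi.single_apply]
  rw [this]
  simp

/-- `fderivWithin` is arbitrary in the normal direction and need not be continuous; but some
continuous local derivative exists, and it gives the same values on the rows of `P_Γ`. -/
theorem IsC2Surface.continuousOn_surfDeriv (hS : IsC2Surface S) (hn : IsUnitNormalField S n)
    {f : E3 → ℝ} (hf : ContDiffOn ℝ 1 f S) (i : Fin 3) :
    ContinuousOn (surfDeriv S n i f) S := fun x hx => by
  have h := hf x hx
  rw [show (1 : WithTop ℕ∞) = 0 + 1 by norm_num,
    contDiffWithinAt_succ_iff_hasFDerivWithinAt' (by norm_num), insert_eq_of_mem hx] at h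
  obtain ⟨u, hu, -, -, f', hf', hcf'⟩ := h
  have hP : ContinuousOn (fun y => (WithLp.toLp 2 fun j => surfProj n y i j : E3)) S :=
    (PiLp.continuous_toLp 2 _).comp_continuousOn
      (continuousOn_pi.2 fun j => (hS.contDiffOn_surfProj hn i j).continuousOn)
  refine (hcf'.continuousWithinAt.clm_apply (hP x hx)).congr_of_eventuallyEq ?_
    (hS.surfDeriv_eq hn hx (hf' x (mem_of_mem_nhdsWithin hx hu)) i)
  filter_upwards [self_mem_nhdsWithin, hu] with y hy hyu
  exact hS.surfDeriv_eq hn hy (hf' y hyu) i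

theorem IsC2Surface.measure_lt_top (hS : IsC2Surface S) (hc : IsCompact S) :
    (μHE[2] : Measure E3) S < ⊤ := by
  refine hc.measure_lt_top_of_nhdsWithin fun x hx => ?_
  obtain ⟨b, g, U, h, hU⟩ := hS.exists_isGraphOn hx
  obtain ⟨ε, hε, hεU⟩ := Metric.nhds_basis_closedBall.mem_iff.1 (h.isOpen.mem_nhds hU)
  exact ⟨S ∩ Metric.closedBall x ε,
    inter_mem_nhdsWithin S (Metric.closedBall_mem_nhds x hε),
    h.measure_inter_lt_top (isCompact_closedBall x ε) hεU⟩

theorem IsC2Surface.integrableOn (hS : IsC2Surface S) (hc : IsCompact S) {f : E3 → ℝ}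
    (hf : ContinuousOn f S) : IntegrableOn f S μHE[2] := by
  obtain ⟨C, hC⟩ := hc.exists_bound_of_continuousOn hf
  have : IsFiniteMeasure ((μHE[2] : Measure E3).restrict S) :=
    ⟨by simpa using hS.measure_lt_top hc⟩
  exact Integrable.of_bound (hf.aestronglyMeasurable hc.measurableSet) C
    ((ae_restrict_iff' hc.measurableSet).2 (ae_of_all _ hC))

/-- The divergence theorem for tangential vector fields on a closed surface. -/
theorem IsC2Surface.integral_surfDiv_eq_zero (hS : IsC2Surface S) (hc : IsCompact S)
    (hn : IsUnitNormalField S n) {X : E3 → E3} (hX : ContDiffOn ℝ 1 X S)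
    (htan : ∀ x ∈ S, inner ℝ (X x) (n x) = 0) :
    ∫ x in S, surfDiv S n X x ∂μHE[2] = 0 := by
  choose! b g U hU hxU using fun x (hx : x ∈ S) => hS.exists_isGraphOn hx
  have hball : ∀ x ∈ S, ∃ ε > 0, Metric.closedBall x ε ⊆ U x := fun x hx =>
    Metric.nhds_basis_closedBall.mem_iff.1 ((hU x hx).isOpen.mem_nhds (hxU x hx))
  choose! ε hε hεU using hball
  obtain ⟨t, htS, hcov⟩ := hc.elim_nhds_subcover (fun x => Metric.ball x (ε x))
    fun x hx => Metric.ball_mem_nhds x (hε x hx)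
  have hbump : ∀ x ∈ t, ∃ β : E3 → ℝ, ContDiff ℝ 1 β ∧ (∀ y, 0 ≤ β y) ∧
      (∀ y ∈ Metric.ball x (ε x), 0 < β y) ∧ ∀ y ∉ Metric.ball x (ε x), β y = 0 := by
    intro x hx
    have := hε x (htS x hx)
    let β : ContDiffBump x := ⟨ε x / 2, ε x, by positivity, by linarith⟩
    refine ⟨β, β.contDiff, fun y => β.nonneg, fun y hy => β.pos_of_mem_ball hy, fun y hy => ?_⟩
    rw [← Function.notMem_support, β.support_eq]
    exact hy
  choose! β hβ hβ0 hβpos hβzero using hbump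
  set B : E3 → ℝ := fun y => ∑ x ∈ t, β x y with hB
  have hBpos : ∀ y ∈ S, 0 < B y := fun y hy => by
    obtain ⟨x, hx, hxy⟩ := mem_iUnion₂.1 (hcov hy)
    exact Finset.sum_pos' (fun z hz => hβ0 z hz y) ⟨x, hx, hβpos x hx y hxy⟩
  have hBc : ContDiff ℝ 1 B := ContDiff.sum fun x hx => hβ x hx
  -- The quotients `β x / B` form a partition of unity on `S`, where `B` is positive. Hence the
  -- localized fields sum to `X` on `S`, and so do their divergences.
  set Y : E3 → E3 → E3 := fun x y => (β x y / B y) • X y with hYdef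
  have hY : ∀ x ∈ t, ContDiffOn ℝ 1 (Y x) S := fun x hx =>
    ((hβ x hx).contDiffOn.div hBc.contDiffOn fun y hy => (hBpos y hy).ne').smul hX
  have hYcoord : ∀ x ∈ t, ∀ j : Fin 3, ∀ y ∈ S, DifferentiableWithinAt ℝ (fun z => Y x z j) S y :=
    fun x hx j y hy => (EuclideanSpace.proj (𝕜 := ℝ) j).differentiableAt.comp_differentiableWithinAt
      y ((hY x hx y hy).differentiableWithinAt one_ne_zero)
  have hsum : ∀ y ∈ S, surfDiv S n X y = ∑ x ∈ t, surfDiv S n (Y x) y := by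
    intro y hy
    unfold surfDiv
    rw [Finset.sum_comm]
    refine Finset.sum_congr rfl fun j _ => ?_
    rw [← hS.surfDeriv_sum hn hy t fun x hx => hYcoord x hx j y hy]
    refine surfDeriv_congr (fun z hz => ?_) hy j
    simp only [hYdef, PiLp.smul_apply, smul_eq_mul]
    rw [← Finset.sum_mul, ← Finset.sum_div, div_self (hBpos z hz).ne', one_mul]
  have hint : ∀ x ∈ t, Integrable (surfDiv S n (Y x)) ((μHE[2] : Measure E3).restrict S) :=
    fun x hx => hS.integrableOn hc (continuousOn_finsetSum _ fun j _ =>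
      hS.continuousOn_surfDeriv hn
        ((EuclideanSpace.proj (𝕜 := ℝ) j).contDiff.comp_contDiffOn (hY x hx)) j)
  rw [setIntegral_congr_fun hc.measurableSet hsum, integral_finsetSum _ hint]
  refine Finset.sum_eq_zero fun x hx => ?_
  refine (hU x (htS x hx)).integral_surfDiv_eq_zero hc.measurableSet hn
    (isCompact_closedBall x (ε x)) (hεU x (htS x hx)) (hY x hx) (fun y hy => ?_) fun y hy => ?_
  · simp [hYdef, hβzero x hx y fun hy' => hy (Metric.ball_subset_closedBall hy')]
  · simp [hYdef, inner_smul_left, htan y hy]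

end ClosedSurface

/-! ### The first variation of the energy -/

section FirstVariation

open MeasureTheory Topology Filter Set

variable {S : Set E3} {n : E3 → E3}

theorem surfProj_transpose (n : E3 → E3) (x : E3) : (surfProj n x)ᵀ = surfProj n x := by
  ext i j
  simp [surfProj, mul_comm, eq_comm]

theorem IsUnitNormalField.sum_sq (hn : IsUnitNormalField S n) {x : E3} (hx : x ∈ S) :
    n x 0 ^ 2 + n x 1 ^ 2 + n x 2 ^ 2 = 1 := by
  have h := congrArg (· ^ 2) (hn x hx).1
  simpa [EuclideanSpace.norm_sq_eq, Fin.sum_univ_three] using h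

theorem IsUnitNormalField.surfProj_mulVec (hn : IsUnitNormalField S n) {x : E3} (hx : x ∈ S) :
    surfProj n x *ᵥ (n x : Fin 3 → ℝ) = 0 := by
  have h := hn.sum_sq hx
  ext i
  fin_cases i <;> simp [surfProj, Matrix.mulVec, dotProduct, Fin.sum_univ_three]
  · linear_combination (-(n x 0)) * h
  · linear_combination (-(n x 1)) * h
  · linear_combination (-(n x 2)) * h

theorem IsUnitNormalField.surfProj_mul_self (hn : IsUnitNormalField S n) {x : E3} (hx : x ∈ S) :
    surfProj n x * surfProj n x = surfProj n x := by
  have h1 : surfProj n x = 1 - Matrix.vecMulVec (n x : Fin 3 → ℝ) (n x : Fin 3 → ℝ) := by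
    ext i j
    simp [surfProj, Matrix.one_apply, Matrix.vecMulVec_apply]
  conv_lhs => enter [2]; rw [h1]
  rw [mul_sub, mul_one, Matrix.mul_vecMulVec, hn.surfProj_mulVec hx]
  simp

/-- The part of `w` removed by `P_Γ` is a multiple of `n`, which `y` does not see. -/
theorem inner_matVec_surfProj {n : E3 → E3} {x w y : E3} (h : inner ℝ y (n x) = 0) :
    inner ℝ (matVec (surfProj n x) w) y = (inner ℝ w y : ℝ) := by
  simp only [PiLp.inner_apply, Fin.sum_univ_three, RCLike.inner_apply, conj_trivial] at h
  simp [PiLp.inner_apply, matVec, surfProj, Fin.sum_univ_three]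
  linear_combination (-(n x 0 * w 0 + n x 1 * w 1 + n x 2 * w 2)) * h

theorem inner_tangentialForce (mu lam σ ρ : E3 → ℝ) (F V : E3 → E3) {x y : E3}
    (h : inner ℝ y (n x) = 0) :
    inner ℝ (tangentialForce S n mu lam σ ρ F V x) y =
      (inner ℝ (totalForce S n mu lam σ ρ F V x) y : ℝ) := by
  rw [tangentialForce, totalForce, inner_add_left, inner_add_left, inner_matVec_surfProj h,
    inner_matVec_surfProj h]

/-! #### The velocity gradient -/

/-- The velocity gradient, with entries `∂ⱼ Vᵢ`. -/
noncomputable def velocityGradient (V : E3 → E3) (x : E3) : Matrix (Fin 3) (Fin 3) ℝ :=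
  Matrix.of fun i j => fderiv ℝ (fun y => V y i) x (EuclideanSpace.single j 1)

theorem strainRate_eq (V : E3 → E3) (x : E3) :
    strainRate V x = (1 / 2 : ℝ) • (velocityGradient V x + (velocityGradient V x)ᵀ) := by
  ext i j
  simp [strainRate, velocityGradient]
  ring

theorem differentiable_coord {V : E3 → E3} (hV : ContDiff ℝ ∞ V) (i : Fin 3) :
    Differentiable ℝ fun y => V y i :=
  (contDiff_euclidean.1 hV i).differentiable (by simp)

theorem contDiff_velocityGradient {V : E3 → E3} (hV : ContDiff ℝ ∞ V) (i j : Fin 3) :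
    ContDiff ℝ 1 fun x => velocityGradient V x i j :=
  ((contDiff_euclidean.1 hV i).fderiv_right (m := 1) (by norm_cast)).clm_apply contDiff_const

theorem velocityGradient_add_smul {V W : E3 → E3} (hV : ContDiff ℝ ∞ V) (hW : ContDiff ℝ ∞ W)
    (ε : ℝ) (x : E3) : velocityGradient (fun y => V y + ε • W y) x =
      velocityGradient V x + ε • velocityGradient W x := by
  ext i j
  have h := ((differentiable_coord hV i x).hasFDerivAt.add
    ((differentiable_coord hW i x).hasFDerivAt.const_mul ε)).fderiv
  change fderiv ℝ (fun y => V y i + ε * W y i) x = _ at h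
  simp [velocityGradient, h]

theorem surfStrainRate_add_smul {V W : E3 → E3} (hV : ContDiff ℝ ∞ V) (hW : ContDiff ℝ ∞ W)
    (ε : ℝ) (x : E3) : surfStrainRate n (fun y => V y + ε • W y) x =
      surfStrainRate n V x + ε • surfStrainRate n W x := by
  have h : strainRate (fun y => V y + ε • W y) x = strainRate V x + ε • strainRate W x := by
    simp only [strainRate_eq, velocityGradient_add_smul hV hW, Matrix.transpose_add,
      Matrix.transpose_smul]
    module
  rw [surfStrainRate, h, mul_add, add_mul, mul_smul_comm, smul_mul_assoc]
  rfl

theorem IsC2Surface.surfDiv_eq (hS : IsC2Surface S) (hn : IsUnitNormalField S n) {V : E3 → E3}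
    (hV : ContDiff ℝ ∞ V) {x : E3} (hx : x ∈ S) :
    surfDiv S n V x = ∑ j, ∑ k, surfProj n x j k * velocityGradient V x j k :=
  Finset.sum_congr rfl fun j _ => hS.surfDeriv_eq_sum hn hx (differentiable_coord hV j x) j

theorem IsC2Surface.surfDiv_add_smul (hS : IsC2Surface S) (hn : IsUnitNormalField S n)
    {V W : E3 → E3} (hV : ContDiff ℝ ∞ V) (hW : ContDiff ℝ ∞ W) (ε : ℝ) {x : E3} (hx : x ∈ S) :
    surfDiv S n (fun y => V y + ε • W y) x = surfDiv S n V x + ε * surfDiv S n W x := by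
  rw [hS.surfDiv_eq hn (hV.add (hW.const_smul ε)) hx, hS.surfDiv_eq hn hV hx,
    hS.surfDiv_eq hn hW hx, velocityGradient_add_smul hV hW]
  simp only [Matrix.add_apply, Matrix.smul_apply, smul_eq_mul, Finset.mul_sum,
    ← Finset.sum_add_distrib]
  exact Finset.sum_congr rfl fun j _ => Finset.sum_congr rfl fun k _ => by ring

theorem IsC2Surface.contDiffOn_surfDiv (hS : IsC2Surface S) (hn : IsUnitNormalField S n)
    {V : E3 → E3} (hV : ContDiff ℝ ∞ V) : ContDiffOn ℝ 1 (surfDiv S n V) S :=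
  (ContDiffOn.sum fun j _ => ContDiffOn.sum fun k _ =>
    (hS.contDiffOn_surfProj hn j k).mul (contDiff_velocityGradient hV j k).contDiffOn).congr
    fun _ hx => hS.surfDiv_eq hn hV hx

theorem IsC2Surface.contDiffOn_surfStrainRate (hS : IsC2Surface S) (hn : IsUnitNormalField S n)
    {V : E3 → E3} (hV : ContDiff ℝ ∞ V) (i j : Fin 3) :
    ContDiffOn ℝ 1 (fun x => surfStrainRate n V x i j) S := by
  simp only [surfStrainRate, Matrix.mul_apply, strainRate_eq, Matrix.smul_apply, Matrix.add_apply,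
    Matrix.transpose_apply]
  exact ContDiffOn.sum fun l _ => (ContDiffOn.sum fun k _ => (hS.contDiffOn_surfProj hn i k).mul
    (((contDiff_velocityGradient hV k l).add
      (contDiff_velocityGradient hV l k)).const_smul _).contDiffOn).mul
    (hS.contDiffOn_surfProj hn l j)

theorem IsC2Surface.contDiffOn_surfStress (hS : IsC2Surface S) (hn : IsUnitNormalField S n)
    {V : E3 → E3} (hV : ContDiff ℝ ∞ V) {σ mu lam : E3 → ℝ} (hσ : ContDiff ℝ ∞ σ)
    (hmu : ContDiff ℝ ∞ mu) (hlam : ContDiff ℝ ∞ lam) (i j : Fin 3) :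
    ContDiffOn ℝ 1 (fun x => surfStress S n V σ mu lam x i j) S := by
  have h1 : (1 : WithTop ℕ∞) ≤ ∞ := by norm_cast
  simp only [surfStress, Matrix.sub_apply, Matrix.add_apply, Matrix.smul_apply, smul_eq_mul]
  exact (((contDiffOn_const.mul (hmu.of_le h1).contDiffOn).mul
    (hS.contDiffOn_surfStrainRate hn hV i j)).add
    (((hlam.of_le h1).contDiffOn.mul (hS.contDiffOn_surfDiv hn hV)).mul
      (hS.contDiffOn_surfProj hn i j))).sub
    ((hσ.of_le h1).contDiffOn.mul (hS.contDiffOn_surfProj hn i j))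

/-! #### Algebra of the stress tensor -/

/-- The double contraction `M : N` of two matrices. -/
def frobInner (M N : Matrix (Fin 3) (Fin 3) ℝ) : ℝ := ∑ i, ∑ j, M i j * N i j

theorem frobInner_eq_trace (M N : Matrix (Fin 3) (Fin 3) ℝ) :
    frobInner M N = (M * Nᵀ).trace := by
  simp [frobInner, Matrix.trace, Matrix.mul_apply]

theorem frobSq_add_smul (M N : Matrix (Fin 3) (Fin 3) ℝ) (ε : ℝ) :
    frobSq (M + ε • N) = frobSq M + 2 * ε * frobInner M N + ε ^ 2 * frobSq N := by
  simp only [frobSq, frobInner, Matrix.add_apply, Matrix.smul_apply, smul_eq_mul, Finset.mul_sum,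
    ← Finset.sum_add_distrib]
  exact Finset.sum_congr rfl fun j _ => Finset.sum_congr rfl fun k _ => by ring

/-- `P H P` absorbs factors `P` on both sides under the trace and, being symmetric, pairs only with
the symmetric part of `G`. -/
theorem frobInner_projection {P G H : Matrix (Fin 3) (Fin 3) ℝ} (hP : Pᵀ = P) (hPP : P * P = P)
    (hH : Hᵀ = H) :
    frobInner (P * H * P) (G * P) = frobInner (P * H * P) (P * ((1 / 2 : ℝ) • (G + Gᵀ)) * P) := by
  have e : P * H * P * P = P * H * P := by rw [mul_assoc, hPP]
  have e' : P * (P * H * P) = P * H * P := by rw [← mul_assoc, ← mul_assoc, hPP]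
  have t1 : ∀ A : Matrix (Fin 3) (Fin 3) ℝ, (P * H * P * (P * A * P)).trace =
      (P * H * P * A).trace := fun A => by
    rw [← mul_assoc, Matrix.trace_mul_comm, ← mul_assoc, ← mul_assoc, e', e]
  have t2 : (P * H * P * G).trace = (P * H * P * Gᵀ).trace := by
    rw [← Matrix.trace_transpose, Matrix.transpose_mul, Matrix.trace_mul_comm]
    simp only [Matrix.transpose_mul, hP, hH, mul_assoc]
  rw [frobInner_eq_trace, frobInner_eq_trace]
  simp only [Matrix.transpose_mul, Matrix.transpose_smul, Matrix.transpose_add,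
    Matrix.transpose_transpose, hP]
  rw [← mul_assoc (P * H * P), e, ← mul_assoc P (_ • _) P, t1, mul_smul_comm, mul_add,
    Matrix.trace_smul, Matrix.trace_add, t2, smul_eq_mul]
  ring

theorem strainRate_transpose (V : E3 → E3) (x : E3) : (strainRate V x)ᵀ = strainRate V x := by
  rw [strainRate_eq, Matrix.transpose_smul, Matrix.transpose_add, Matrix.transpose_transpose,
    add_comm]

/-- Every term of the stress ends in a factor `P_Γ`, which kills `n`. This makes `ᵗS_Γ W`
tangential. -/
theorem surfStress_mulVec_normal (hn : IsUnitNormalField S n) (V : E3 → E3) (σ mu lam : E3 → ℝ)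
    {x : E3} (hx : x ∈ S) : surfStress S n V σ mu lam x *ᵥ (n x : Fin 3 → ℝ) = 0 := by
  simp only [surfStress, surfStrainRate, Matrix.sub_mulVec, Matrix.add_mulVec, Matrix.smul_mulVec,
    ← Matrix.mulVec_mulVec, hn.surfProj_mulVec hx, Matrix.mulVec_zero, smul_zero, add_zero,
    sub_zero]

/-- The power of the surface stress. -/
theorem IsC2Surface.frobInner_surfStress (hS : IsC2Surface S) (hn : IsUnitNormalField S n)
    {V W : E3 → E3} (hW : ContDiff ℝ ∞ W) (σ mu lam : E3 → ℝ) {x : E3} (hx : x ∈ S) :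
    frobInner (surfStress S n V σ mu lam x) (velocityGradient W x * surfProj n x) =
      2 * mu x * frobInner (surfStrainRate n V x) (surfStrainRate n W x) +
        lam x * surfDiv S n V x * surfDiv S n W x - σ x * surfDiv S n W x := by
  have hP := surfProj_transpose n x
  have hPP := hn.surfProj_mul_self hx
  have h1 : frobInner (surfStrainRate n V x) (velocityGradient W x * surfProj n x) =
      frobInner (surfStrainRate n V x) (surfStrainRate n W x) := by
    rw [surfStrainRate, surfStrainRate, frobInner_projection hP hPP (strainRate_transpose V x),
      ← strainRate_eq]
  have h2 : frobInner (surfProj n x) (velocityGradient W x * surfProj n x) = surfDiv S n W x := by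
    rw [hS.surfDiv_eq hn hW hx, frobInner_eq_trace, Matrix.transpose_mul, hP, ← mul_assoc, hPP,
      ← frobInner_eq_trace, frobInner]
  rw [← h1, ← h2, frobInner_eq_trace, surfStress]
  simp only [sub_mul, add_mul, smul_mul_assoc, Matrix.trace_sub, Matrix.trace_add,
    Matrix.trace_smul, ← frobInner_eq_trace, smul_eq_mul]

/-- The product rule for the divergence of the stress applied to a velocity field. -/
theorem IsC2Surface.surfDiv_stress_apply (hS : IsC2Surface S) (hn : IsUnitNormalField S n)
    {M : E3 → Matrix (Fin 3) (Fin 3) ℝ} (hM : ∀ i j, ContDiffOn ℝ 1 (fun x => M x i j) S)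
    {W : E3 → E3} (hW : ContDiff ℝ ∞ W) {x : E3} (hx : x ∈ S) :
    surfDiv S n (fun y => WithLp.toLp 2 fun j => ∑ i, M y i j * W y i) x =
      inner ℝ (surfDivMat S n M x) (W x) +
        frobInner (M x) (velocityGradient W x * surfProj n x) := by
  have hMd := fun i j => (hM i j x hx).differentiableWithinAt one_ne_zero
  have hWd := fun i => (differentiable_coord hW i x).differentiableWithinAt (s := S)
  have h1 : ∀ j, surfDeriv S n j (fun y => ∑ i, M y i j * W y i) x =
      ∑ i, (surfDeriv S n j (fun y => M y i j) x * W x i +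
        M x i j * (velocityGradient W x * surfProj n x) i j) := fun j => by
    rw [hS.surfDeriv_sum hn hx _ fun i _ => (hMd i j).fun_mul (hWd i)]
    refine Finset.sum_congr rfl fun i _ => ?_
    rw [hS.surfDeriv_mul hn hx (hMd i j) (hWd i),
      hS.surfDeriv_eq_sum hn hx (differentiable_coord hW i x)]
    congr 2
    rw [Matrix.mul_apply]
    refine Finset.sum_congr rfl fun k _ => ?_
    rw [← surfProj_transpose n x, Matrix.transpose_apply, surfProj_transpose, mul_comm]
    rfl
  simp only [surfDiv, h1, Finset.sum_add_distrib]
  rw [Finset.sum_comm, Finset.sum_comm (f := fun j i => M x i j * _), frobInner]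
  congr 1
  simp [PiLp.inner_apply, surfDivMat, Finset.mul_sum, mul_comm]

end FirstVariation

/-! ### The energy along a line of velocity fields -/

section EnergyVariation

open MeasureTheory Topology Filter Set

variable {S : Set E3} {n : E3 → E3}

theorem IsC2Surface.dissipationDensity_add_smul (hS : IsC2Surface S) (hn : IsUnitNormalField S n)
    (mu lam : E3 → ℝ) {V W : E3 → E3} (hV : ContDiff ℝ ∞ V) (hW : ContDiff ℝ ∞ W) (ε : ℝ)
    {x : E3} (hx : x ∈ S) :
    dissipationDensity S n mu lam (fun y => V y + ε • W y) x =
      dissipationDensity S n mu lam V x +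
        ε * (2 * mu x * frobInner (surfStrainRate n V x) (surfStrainRate n W x) +
          lam x * surfDiv S n V x * surfDiv S n W x) +
        ε ^ 2 * dissipationDensity S n mu lam W x := by
  simp only [dissipationDensity, surfStrainRate_add_smul hV hW, hS.surfDiv_add_smul hn hV hW ε hx,
    frobSq_add_smul, sq_abs]
  ring

theorem IsC2Surface.continuousOn_dissipationDensity (hS : IsC2Surface S)
    (hn : IsUnitNormalField S n) {mu lam : E3 → ℝ} (hmu : ContDiff ℝ ∞ mu)
    (hlam : ContDiff ℝ ∞ lam) {V : E3 → E3} (hV : ContDiff ℝ ∞ V) :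
    ContinuousOn (dissipationDensity S n mu lam V) S := by
  have h1 := fun i j => (hS.contDiffOn_surfStrainRate hn hV i j).continuousOn
  have h2 := (hS.contDiffOn_surfDiv hn hV).continuousOn
  exact continuousOn_const.mul (((continuousOn_const.mul hmu.continuous.continuousOn).mul
    (continuousOn_finsetSum _ fun i _ => continuousOn_finsetSum _ fun j _ =>
      (h1 i j).mul (h1 i j))).add (hlam.continuous.continuousOn.mul (h2.abs.pow 2)))

theorem IsC2Surface.continuousOn_surfDivMat (hS : IsC2Surface S) (hn : IsUnitNormalField S n)
    {M : E3 → Matrix (Fin 3) (Fin 3) ℝ} (hM : ∀ i j, ContDiffOn ℝ 1 (fun x => M x i j) S) :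
    ContinuousOn (surfDivMat S n M) S :=
  (PiLp.continuous_toLp 2 _).comp_continuousOn (continuousOn_pi.2 fun i =>
    continuousOn_finsetSum _ fun j _ => hS.continuousOn_surfDeriv hn (hM i j) j)

theorem IsC2Surface.continuousOn_totalForce (hS : IsC2Surface S) (hn : IsUnitNormalField S n)
    {mu lam σ ρ : E3 → ℝ} {F V : E3 → E3} (hV : ContDiff ℝ ∞ V) (hF : ContDiff ℝ ∞ F)
    (hρ : ContDiff ℝ ∞ ρ) (hσ : ContDiff ℝ ∞ σ) (hmu : ContDiff ℝ ∞ mu)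
    (hlam : ContDiff ℝ ∞ lam) : ContinuousOn (totalForce S n mu lam σ ρ F V) S :=
  (hS.continuousOn_surfDivMat hn (hS.contDiffOn_surfStress hn hV hσ hmu hlam)).add
    (hρ.continuous.smul hF.continuous).continuousOn

/-- Integration by parts: the power of the surface stress is minus the power of its divergence. -/
theorem IsC2Surface.integral_inner_surfDivMat (hS : IsC2Surface S) (hc : IsCompact S)
    (hn : IsUnitNormalField S n) {M : E3 → Matrix (Fin 3) (Fin 3) ℝ}
    (hM : ∀ i j, ContDiffOn ℝ 1 (fun x => M x i j) S)
    (hMn : ∀ x ∈ S, M x *ᵥ (n x : Fin 3 → ℝ) = 0) {W : E3 → E3} (hW : ContDiff ℝ ∞ W) :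
    ∫ x in S, (inner ℝ (surfDivMat S n M x) (W x) +
      frobInner (M x) (velocityGradient W x * surfProj n x)) ∂μHE[2] = 0 := by
  rw [← hS.integral_surfDiv_eq_zero hc hn
    (X := fun y => WithLp.toLp 2 fun j => ∑ i, M y i j * W y i)]
  · exact setIntegral_congr_fun hc.measurableSet fun x hx =>
      (hS.surfDiv_stress_apply hn hM hW hx).symm
  · exact contDiffOn_euclidean.2 fun j =>
      show ContDiffOn ℝ 1 (fun y => ∑ i, M y i j * W y i) S from ContDiffOn.sum fun i _ =>
        (hM i j).mul ((contDiff_euclidean.1 hW i).of_le (by norm_cast)).contDiffOn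
  -- The inner product of `ᵗM W` with `n` is that of `W` with `M n`, which is zero.
  · intro x hx
    have h := hMn x hx
    have h1 : ∑ i, W x i * (M x *ᵥ (n x : Fin 3 → ℝ)) i = 0 := by simp [h]
    rw [← h1]
    simp only [PiLp.inner_apply, RCLike.inner_apply, conj_trivial, Matrix.mulVec, dotProduct,
      Finset.mul_sum]
    rw [Finset.sum_comm]
    exact Finset.sum_congr rfl fun i _ => Finset.sum_congr rfl fun j _ => by ring

theorem IsC2Surface.hasDerivAt_totalEnergy (hS : IsC2Surface S) (hc : IsCompact S)
    (hn : IsUnitNormalField S n) {mu lam σ ρ : E3 → ℝ} {F V W : E3 → E3}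
    (hV : ContDiff ℝ ∞ V) (hF : ContDiff ℝ ∞ F) (hρ : ContDiff ℝ ∞ ρ) (hσ : ContDiff ℝ ∞ σ)
    (hmu : ContDiff ℝ ∞ mu) (hlam : ContDiff ℝ ∞ lam) (hW : ContDiff ℝ ∞ W) :
    HasDerivAt (fun ε : ℝ => totalEnergy S n mu lam σ ρ F (fun x => V x + ε • W x))
      (∫ x in S, inner ℝ (totalForce S n mu lam σ ρ F V x) (W x) ∂μHE[2]) 0 := by
  set A : E3 → ℝ := fun x => 2 * mu x * frobInner (surfStrainRate n V x) (surfStrainRate n W x) +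
    lam x * surfDiv S n V x * surfDiv S n W x with hA
  have hD := fun {Z : E3 → E3} (hZ : ContDiff ℝ ∞ Z) => hS.integrableOn hc
    (hS.continuousOn_dissipationDensity hn hmu hlam hZ)
  have hdiv := fun {Z : E3 → E3} (hZ : ContDiff ℝ ∞ Z) =>
    (hS.contDiffOn_surfDiv hn hZ).continuousOn
  have hAi : IntegrableOn A S μHE[2] := by
    refine hS.integrableOn hc (ContinuousOn.add ?_ ?_)
    · exact (continuousOn_const.mul hmu.continuous.continuousOn).mul
        (continuousOn_finsetSum _ fun i _ => continuousOn_finsetSum _ fun j _ =>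
          (hS.contDiffOn_surfStrainRate hn hV i j).continuousOn.mul
            (hS.contDiffOn_surfStrainRate hn hW i j).continuousOn)
    · exact (hlam.continuous.continuousOn.mul (hdiv hV)).mul (hdiv hW)
  have hP := fun {Z : E3 → E3} (hZ : ContDiff ℝ ∞ Z) => hS.integrableOn hc
    (f := pressureWorkDensity S n σ Z) ((hdiv hZ).mul hσ.continuous.continuousOn)
  have hFo := fun {Z : E3 → E3} (hZ : ContDiff ℝ ∞ Z) => hS.integrableOn hc
    (f := forceWorkDensity ρ F Z)
    ((hρ.continuous.smul hF.continuous).inner hZ.continuous).continuousOn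
  -- The energy is a quadratic polynomial in `ε`, with `A` the polarized dissipation density.
  have hpoly : (fun ε : ℝ => totalEnergy S n mu lam σ ρ F (fun x => V x + ε • W x)) =
      fun ε => totalEnergy S n mu lam σ ρ F V +
        ε * (-(∫ x in S, A x ∂μHE[2]) + pressureWork S n σ W + forceWork S ρ F W) +
        ε ^ 2 * dissipationEnergy S n mu lam W := by
    funext ε
    have e1 : dissipationEnergy S n mu lam (fun x => V x + ε • W x) =
        dissipationEnergy S n mu lam V - ε * (∫ x in S, A x ∂μHE[2]) +
          ε ^ 2 * dissipationEnergy S n mu lam W := by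
      simp only [dissipationEnergy]
      rw [setIntegral_congr_fun hc.measurableSet fun x hx =>
        hS.dissipationDensity_add_smul hn mu lam hV hW ε hx, integral_add, integral_add,
        integral_const_mul, integral_const_mul]
      · ring
      · exact hD hV
      · exact hAi.const_mul ε
      · exact (hD hV).add (hAi.const_mul ε)
      · exact (hD hW).const_mul _
    have e2 : pressureWork S n σ (fun x => V x + ε • W x) =
        pressureWork S n σ V + ε * pressureWork S n σ W := by
      simp only [pressureWork]
      rw [← integral_const_mul, ← integral_add (hP hV) ((hP hW).const_mul ε)]
      refine setIntegral_congr_fun hc.measurableSet fun x hx => ?_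
      simp only [pressureWorkDensity, hS.surfDiv_add_smul hn hV hW ε hx]
      ring
    have e3 : forceWork S ρ F (fun x => V x + ε • W x) =
        forceWork S ρ F V + ε * forceWork S ρ F W := by
      simp only [forceWork]
      rw [← integral_const_mul, ← integral_add (hFo hV) ((hFo hW).const_mul ε)]
      refine setIntegral_congr_fun hc.measurableSet fun x hx => ?_
      simp only [forceWorkDensity, inner_add_right, inner_smul_right]
    simp only [totalEnergy, e1, e2, e3]
    ring
  have hM := hS.contDiffOn_surfStress hn hV hσ hmu hlam
  -- The difference of the two sides is the integral of `div_Γ S_Γ · W + S_Γ : (∇W P_Γ)`, which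
  -- vanishes by integration by parts; the force terms cancel.
  have hfirst : ∫ x in S, inner ℝ (totalForce S n mu lam σ ρ F V x) (W x) ∂μHE[2] =
      -(∫ x in S, A x ∂μHE[2]) + pressureWork S n σ W + forceWork S ρ F W := by
    have hI1 : IntegrableOn (fun x => inner ℝ (totalForce S n mu lam σ ρ F V x) (W x)) S μHE[2] :=
      hS.integrableOn hc ((hS.continuousOn_totalForce hn hV hF hρ hσ hmu hlam).inner
        hW.continuous.continuousOn)
    have hI2 : IntegrableOn (fun x => -A x) S μHE[2] := hAi.neg
    have hI3 : IntegrableOn (fun x => -A x + pressureWorkDensity S n σ W x) S μHE[2] :=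
      hI2.add (hP hW)
    have hI4 : IntegrableOn (fun x => -A x + pressureWorkDensity S n σ W x +
      forceWorkDensity ρ F W x) S μHE[2] := hI3.add (hFo hW)
    rw [← sub_eq_zero, pressureWork, forceWork, ← integral_neg, ← integral_add hI2 (hP hW),
      ← integral_add hI3 (hFo hW), ← integral_sub hI1 hI4,
      ← hS.integral_inner_surfDivMat hc hn hM
        (fun x hx => surfStress_mulVec_normal hn V σ mu lam hx) hW]
    refine setIntegral_congr_fun hc.measurableSet fun x hx => ?_
    simp only [hS.frobInner_surfStress hn hW σ mu lam hx, totalForce, inner_add_left,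
      pressureWorkDensity, forceWorkDensity, hA]
    ring
  rw [hpoly, hfirst]
  have hid := hasDerivAt_id (0 : ℝ)
  have h := ((hid.mul_const (-(∫ x in S, A x ∂μHE[2]) + pressureWork S n σ W +
    forceWork S ρ F W)).const_add (totalEnergy S n mu lam σ ρ F V)).fun_add
    ((hid.fun_pow 2).mul_const (dissipationEnergy S n mu lam W))
  simpa using h

/-- The slice of the local level function at time `t` is a `C²` defining function. -/
theorem IsEvolvingSurface.isC2Surface {T : EReal} {Γ : ℝ → Set E3} (hΓ : IsEvolvingSurface T Γ)
    {t : ℝ} (ht0 : 0 < t) (htT : (t : EReal) < T) : IsC2Surface (Γ t) := by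
  intro x hx
  obtain ⟨r₁, r₂, hr₁, hr₂, ψ, hψ, hΓψ, hne⟩ := hΓ.regular t ht0 htT x hx
  have ht : t ∈ Set.Ioi 0 ∩ Metric.ball t r₂ := ⟨ht0, Metric.mem_ball_self hr₂⟩
  exact ⟨r₁, hr₁, fun y => ψ y t, hψ.2.1 t ht, hΓψ, fun y hy => hne y hy t ht⟩

end EnergyVariation

theorem theorem1p5
    (T : EReal) (Γ : ℝ → Set E3) (hΓ : IsEvolvingSurface T Γ)
    (n : E3 → ℝ → E3)
    (hn : ∀ t : ℝ, 0 ≤ t → (t : EReal) < T → IsUnitNormalField (Γ t) (fun x => n x t))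
    (v F : E3 → ℝ → E3) (ρ σ mu lam : E3 → ℝ → ℝ)
    (hv : ContDiff ℝ ∞ (Function.uncurry v)) (hF : ContDiff ℝ ∞ (Function.uncurry F))
    (hρ : ContDiff ℝ ∞ (Function.uncurry ρ)) (hσ : ContDiff ℝ ∞ (Function.uncurry σ))
    (hmu : ContDiff ℝ ∞ (Function.uncurry mu)) (hlam : ContDiff ℝ ∞ (Function.uncurry lam))
    (t : ℝ) (ht0 : 0 < t) (htT : (t : EReal) < T)
    (φ : E3 → E3) (hφ : ContDiff ℝ ∞ φ) :
    -- all derivatives and integrals below are meaningful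
    (∀ x ∈ Γ t, ∀ i j : Fin 3, DifferentiableWithinAt ℝ
      (fun y => surfStress (Γ t) (n · t) (v · t) (σ · t) (mu · t) (lam · t) y i j) (Γ t) x) ∧
    (∀ ε : ℝ,
      MeasureTheory.IntegrableOn
        (dissipationDensity (Γ t) (n · t) (mu · t) (lam · t) (fun x => v x t + ε • φ x))
        (Γ t) μHE[2] ∧
      MeasureTheory.IntegrableOn
        (pressureWorkDensity (Γ t) (n · t) (σ · t) (fun x => v x t + ε • φ x)) (Γ t) μHE[2] ∧
      MeasureTheory.IntegrableOn
        (forceWorkDensity (ρ · t) (F · t) (fun x => v x t + ε • φ x)) (Γ t) μHE[2]) ∧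
    MeasureTheory.IntegrableOn
      (fun x => inner ℝ
        (totalForce (Γ t) (n · t) (mu · t) (lam · t) (σ · t) (ρ · t) (F · t) (v · t) x) (φ x))
      (Γ t) μHE[2] ∧
    -- the first variation in an arbitrary direction
    HasDerivAt
      (fun ε : ℝ => totalEnergy (Γ t) (n · t) (mu · t) (lam · t) (σ · t) (ρ · t) (F · t)
        (fun x => v x t + ε • φ x))
      (∫ x in Γ t, inner ℝ
        (totalForce (Γ t) (n · t) (mu · t) (lam · t) (σ · t) (ρ · t) (F · t) (v · t) x) (φ x)
        ∂μHE[2]) 0 ∧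
    -- the first variation in a tangential direction
    ((∀ x ∈ Γ t, inner ℝ (φ x) (n x t) = 0) →
      MeasureTheory.IntegrableOn
        (fun x => inner ℝ
          (tangentialForce (Γ t) (n · t) (mu · t) (lam · t) (σ · t) (ρ · t) (F · t) (v · t) x)
          (φ x))
        (Γ t) μHE[2] ∧
      HasDerivAt
        (fun ε : ℝ => totalEnergy (Γ t) (n · t) (mu · t) (lam · t) (σ · t) (ρ · t) (F · t)
          (fun x => v x t + ε • φ x))
        (∫ x in Γ t, inner ℝ
          (tangentialForce (Γ t) (n · t) (mu · t) (lam · t) (σ · t) (ρ · t) (F · t) (v · t) x)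
          (φ x) ∂μHE[2]) 0) := by
  have hS := hΓ.isC2Surface ht0 htT
  have hc := hΓ.closed t ht0.le htT
  have hnt := hn t ht0.le htT
  have hpair : ContDiff ℝ ∞ fun x : E3 => (x, t) := contDiff_id.prodMk contDiff_const
  have hv' : ContDiff ℝ ∞ (v · t) := hv.comp hpair
  have hF' : ContDiff ℝ ∞ (F · t) := hF.comp hpair
  have hρ' : ContDiff ℝ ∞ (ρ · t) := hρ.comp hpair
  have hσ' : ContDiff ℝ ∞ (σ · t) := hσ.comp hpair
  have hmu' : ContDiff ℝ ∞ (mu · t) := hmu.comp hpair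
  have hlam' : ContDiff ℝ ∞ (lam · t) := hlam.comp hpair
  have hforce := hS.integrableOn hc ((hS.continuousOn_totalForce hnt hv' hF' hρ' hσ' hmu'
    hlam').inner hφ.continuous.continuousOn)
  have hderiv := hS.hasDerivAt_totalEnergy hc hnt hv' hF' hρ' hσ' hmu' hlam' hφ
  refine ⟨fun x hx i j => (hS.contDiffOn_surfStress hnt hv' hσ' hmu' hlam' i j x
    hx).differentiableWithinAt one_ne_zero, fun ε => ?_, hforce, hderiv, fun htan => ?_⟩
  · have hV : ContDiff ℝ ∞ fun x => v x t + ε • φ x := hv'.add (hφ.const_smul ε)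
    exact ⟨hS.integrableOn hc (hS.continuousOn_dissipationDensity hnt hmu' hlam' hV),
      hS.integrableOn hc ((hS.contDiffOn_surfDiv hnt hV).continuousOn.mul
        hσ'.continuous.continuousOn),
      hS.integrableOn hc
        ((hρ'.continuous.smul hF'.continuous).inner hV.continuous).continuousOn⟩
  -- For tangential `φ` the two force fields have the same power at each point of `Γ t`, so the
  -- general case applies.
  · have hpt : ∀ x ∈ Γ t, (inner ℝ (tangentialForce (Γ t) (n · t) (mu · t) (lam · t) (σ · t)
        (ρ · t) (F · t) (v · t) x) (φ x) : ℝ) = inner ℝ (totalForce (Γ t) (n · t) (mu · t)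
        (lam · t) (σ · t) (ρ · t) (F · t) (v · t) x) (φ x) := fun x hx =>
      inner_tangentialForce _ _ _ _ _ _ (htan x hx)
    rw [MeasureTheory.integrableOn_congr_fun hpt hc.measurableSet,
      MeasureTheory.setIntegral_congr_fun hc.measurableSet hpt]
    exact ⟨hforce, hderiv⟩
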